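/- Let $n_1,\dots,n_K\ge 2$, $n=\sum_k n_k$, and let $C$ be a positive definite $n\times n$ block correlation matrix with block sizes $n_1,\dots,n_K$: its diagonal entries are $1$, and all off-diagonal entries in block $(k,l)$ equal $\rho_{kl}$. Let $A$ be the $K\times K$ matrix with $A_{kl}=\rho_{kl}\sqrt{n_kn_l}$ for $k\ne l$ and $A_{kk}=1+(n_k-1)\rho_{kk}$, and let $\lambda_k=(n_k-A_{kk})/(n_k-1)$. Let $v_{n_k}=(1/\sqrt{n_k},\dots,1/\sqrt{n_k})'$, let $v_{n_k}^{\perp}$ be any $n_k\times(n_k-1)$ matrix with orthonormal columns orthogonal to $v_{n_k}$, and let $Q=[\,\mathrm{diag}(v_{n_1},\dots,v_{n_K}),\ \mathrm{diag}(v_{n_1}^{\perp},\dots,v_{n_K}^{\perp})\,]$ (block-diagonal matrices). Square roots of matrices are the symmetric positive definite ones. For $\nu>2$ let $t^{\mathrm{std}}_\nu(0,I_d)$ be the distribution on $\mathbb R^d$ with density $\frac{\Gamma((\nu+d)/2)}{\Gamma(\nu/2)}[(\nu-2)\pi]^{-d/2}\bigl(1+\frac{y'y}{\nu-2}\bigr)^{-(\nu+d)/2}$.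 Let $\nu_0,\dots,\nu_K>2$ and suppose that $Z\sim \mathrm{CT}^{\mathrm{std}}_{m,\nu}(0,C^{1/2}Q)$ with $m=(K,n_1-1,\dots,n_K-1)$, that is, $Z$ is distributed as $C^{1/2}QV$, where $V=(V_0',\dots,V_K')'$ has independent components $V_0\sim t^{\mathrm{std}}_{\nu_0}(0,I_K)$ and $V_k\sim t^{\mathrm{std}}_{\nu_k}(0,I_{n_k-1})$, $k=1,\dots,K$. Write $Y=(Y_0',Y_1',\dots,Y_K')'=Q'Z$ and $X=(X_0',X_1',\dots,X_K')'=Q'C^{-1/2}Z$, partitioned according to $m$. For every positive definite block correlation matrix with these block sizes, the distribution $\mathrm{CT}^{\mathrm{std}}_{m,\nu}(0,C^{1/2}Q)$ has density $e^{\ell}$, where, with $c(\nu,d)=\log\frac{\Gamma((\nu+d)/2)}{\Gamma(\nu/2)}-\frac d2\log[(\nu-2)\pi]$, $$\ell(Z)=c(\nu_0,K)-\tfrac12\log|A|-\tfrac{\nu_0+K}{2}\log\Bigl(1+\tfrac{Y_0'A^{-1}Y_0}{\nu_0-2}\Bigr)+\sum_{k=1}^K\Bigl[c(\nu_k,n_k-1)-\tfrac{n_k-1}{2}\log\lambda_k-\tfrac{\nu_k+n_k-1}{2}\log\Bigl(1+\tfrac{Y_k'Y_k}{(\nu_k-2)\lambda_k}\Bigr)\Bigr].$$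 The score $\nabla_A=\partial\ell/\partial\mathrm{vec}(A)$ (the gradient of this expression with respect to all $K^2$ entries of $A$, the $\lambda_k$ being functions of $A_{kk}$) exists at $A$, and the score and the Fisher information $\mathcal I_A=\mathbb E(\nabla_A\nabla_A')$ (all of whose entries are finite expectations) are $$\nabla_A=\tfrac12\bigl(A^{-1/2}\otimes A^{-1/2}\bigr)\bigl[W_0\,\mathrm{vec}(X_0X_0')-\mathrm{vec}(I_K)\bigr]+\tfrac12E_d'S,$$ $$\mathcal I_A=\tfrac14\bigl[\phi_0\,(A^{-1}\otimes A^{-1})H_K+(\phi_0-1)\,\mathrm{vec}(A^{-1})\mathrm{vec}(A^{-1})'+E_d'\,\Xi\,E_d\bigr].$$ Here $H_K=I_{K^2}+K_K$ with $K_K$ the commutation matrix ($K_K\mathrm{vec}(B)=\mathrm{vec}(B')$), $E_d$ is the $K\times K^2$ matrix with $E_d\mathrm{vec}(B)=\mathrm{diag}(B)$, $\Xi$ is a diagonal $K\times K$ matrix, and for $k=1,\dots,K$ $$W_0=\frac{\nu_0+K}{\nu_0-2+X_0'X_0},\quad W_k=\frac{\nu_k+n_k-1}{\nu_k-2+X_k'X_k},\quad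 \phi_0=\frac{\nu_0+K}{\nu_0+K+2},\quad \phi_k=\frac{\nu_k+n_k-1}{\nu_k+n_k+1},$$ $$S_k=\frac1{\lambda_k}-\frac{W_kX_k'X_k}{\lambda_k(n_k-1)},\qquad \Xi_{kk}=\frac{\phi_k-1}{\lambda_k^2}+\frac{2\phi_k}{\lambda_k^2(n_k-1)}.$$ -/

import Mathlib

open MeasureTheory Matrix
open scoped Kronecker MatrixOrder

noncomputable section

namespace BlockCT

/-! ### Standardized multivariate and convolution t-distributions -/

/-- Density of the standardized (unit-variance scaled) multivariate t-distribution
`t_ν^std(0, Σ)` on `ℝ^d`, defined for `ν > 2`. -/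
def tStdDensity {d : ℕ} (ν : ℝ) (S : Matrix (Fin d) (Fin d) ℝ) (y : Fin d → ℝ) : ℝ :=
  Real.Gamma ((ν + d) / 2) / Real.Gamma (ν / 2) * ((ν - 2) * Real.pi) ^ (-(d : ℝ) / 2)
    * S.det ^ (-(1 : ℝ) / 2) * (1 + 1 / (ν - 2) * (y ⬝ᵥ S⁻¹ *ᵥ y)) ^ (-(ν + d) / 2)

/-- The distribution `t_ν^std(0, Σ)`. -/
def tStd {d : ℕ} (ν : ℝ) (S : Matrix (Fin d) (Fin d) ℝ) : Measure (Fin d → ℝ) :=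
  volume.withDensity fun y => ENNReal.ofReal (tStdDensity ν S y)

/-- The convolution-t distribution `CT^std_{m,ν}(0, B)`: the law of `B V`, where `V` stacks
independent vectors `V_g ∼ t_{ν_g}^std(0, I_{m_g})`. -/
def ctStd {G N : Type*} [Fintype G] [Fintype N] (m : G → ℕ) (ν : G → ℝ)
    (B : Matrix N (Σ g, Fin (m g)) ℝ) : Measure (N → ℝ) :=
  (Measure.pi fun g => tStd (ν g) (1 : Matrix (Fin (m g)) (Fin (m g)) ℝ)).map
    fun V => B *ᵥ fun p => V p.1 p.2

/-! ### Matrix notation -/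

/-- The symmetric positive semidefinite square root `M^{1/2}`. -/
def msqrt {ι : Type*} [Fintype ι] [DecidableEq ι] (M : Matrix ι ι ℝ) : Matrix ι ι ℝ :=
  CFC.sqrt M

/-- Inverse of `vec`: the matrix whose stacked columns are `a`. -/
def unvec {ι : Type*} (a : ι × ι → ℝ) : Matrix ι ι ℝ := Matrix.of fun i j => a (j, i)

/-- The commutation matrix: `commMat *ᵥ vec B = vec Bᵀ`. -/
def commMat (ι : Type*) [DecidableEq ι] : Matrix (ι × ι) (ι × ι) ℝ :=
  Matrix.of fun p q => if p.1 = q.2 ∧ p.2 = q.1 then 1 else 0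

/-- The matrix `E_d`: `diagElim *ᵥ vec B = diag B`. -/
def diagElim (ι : Type*) [DecidableEq ι] : Matrix ι (ι × ι) ℝ :=
  Matrix.of fun k p => if p.1 = k ∧ p.2 = k then 1 else 0

/-! ### Block correlation matrices and their canonical form -/

/-- The `n × n` block matrix `C` with block sizes `n_1, …, n_K`: ones on the diagonal, and every
off-diagonal entry in block `(k, l)` equal to `ρ_{kl}`. -/
def blockCorr {K : ℕ} (n : Fin K → ℕ) (ρ : Matrix (Fin K) (Fin K) ℝ) :
    Matrix (Σ k, Fin (n k)) (Σ k, Fin (n k)) ℝ :=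
  Matrix.of fun p q => if p = q then 1 else ρ p.1 q.1

/-- The `K × K` matrix `A` of the canonical form of `blockCorr n ρ`. -/
def canonA {K : ℕ} (n : Fin K → ℕ) (ρ : Matrix (Fin K) (Fin K) ℝ) : Matrix (Fin K) (Fin K) ℝ :=
  Matrix.of fun k l =>
    if k = l then 1 + ((n k : ℝ) - 1) * ρ k k else ρ k l * √((n k : ℝ) * n l)

/-- `λ_k = (n_k - A_kk) / (n_k - 1)`. -/
def lam {K : ℕ} (n : Fin K → ℕ) (A : Matrix (Fin K) (Fin K) ℝ) (k : Fin K) : ℝ :=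
  ((n k : ℝ) - A k k) / ((n k : ℝ) - 1)

/-- The group dimensions `m = (K, n_1 - 1, …, n_K - 1)`; the group `none` is group `0`. -/
def canonDims {K : ℕ} (n : Fin K → ℕ) : Option (Fin K) → ℕ
  | none => K
  | some k => n k - 1

/-- `F k` is a valid choice of `v_{n_k}^⊥`: orthonormal columns, orthogonal to
`v_{n_k} = (1/√n_k, …, 1/√n_k)'`. -/
def IsPerpBasis {K : ℕ} (n : Fin K → ℕ) (F : ∀ k, Matrix (Fin (n k)) (Fin (n k - 1)) ℝ) : Prop :=
  ∀ k, (F k)ᵀ * F k = 1 ∧ (fun _ : Fin (n k) => 1 / √(n k : ℝ)) ᵥ* F k = 0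

/-- The orthonormal matrix `Q`: its first `K` columns are block-diagonal with blocks `v_{n_k}`,
the remaining ones are block-diagonal with blocks `v_{n_k}^⊥ = F k`. -/
def canonQ {K : ℕ} (n : Fin K → ℕ) (F : ∀ k, Matrix (Fin (n k)) (Fin (n k - 1)) ℝ) :
    Matrix (Σ k, Fin (n k)) (Σ g, Fin (canonDims n g)) ℝ :=
  Matrix.of fun p q =>
    match q with
    | ⟨none, l⟩ => if p.1 = (show Fin K from l) then 1 / √(n p.1 : ℝ) else 0
    | ⟨some k, j⟩ => Matrix.blockDiagonal' F p ⟨k, (show Fin (n k - 1) from j)⟩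

section Model

variable {K : ℕ} (n : Fin K → ℕ) (F : ∀ k, Matrix (Fin (n k)) (Fin (n k - 1)) ℝ)
  (ν : Option (Fin K) → ℝ)

/-- The first `K` canonical variables: `Y_0`, where `Y = Q' z`. -/
def Y0 (z : (Σ k, Fin (n k)) → ℝ) : Fin K → ℝ :=
  fun l => ((canonQ n F)ᵀ *ᵥ z) ⟨none, l⟩

/-- The `k`-th group of the remaining canonical variables: `Y_k`, where `Y = Q' z`. -/
def Yk (z : (Σ k, Fin (n k)) → ℝ) (k : Fin K) : Fin (n k - 1) → ℝ :=
  fun j => ((canonQ n F)ᵀ *ᵥ z) ⟨some k, j⟩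

/-- The standardized canonical variables `X_0`, where `X = Q' U` and `U = C^{-1/2} z`. -/
def X0 (C : Matrix (Σ k, Fin (n k)) (Σ k, Fin (n k)) ℝ) (z : (Σ k, Fin (n k)) → ℝ) :
    Fin K → ℝ :=
  Y0 n F ((msqrt C)⁻¹ *ᵥ z)

/-- The standardized canonical variables `X_k`, where `X = Q' U` and `U = C^{-1/2} z`. -/
def Xk (C : Matrix (Σ k, Fin (n k)) (Σ k, Fin (n k)) ℝ) (z : (Σ k, Fin (n k)) → ℝ)
    (k : Fin K) : Fin (n k - 1) → ℝ :=
  Yk n F ((msqrt C)⁻¹ *ᵥ z) k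

/-- The normalizing constant `c(ν, d)`. -/
def normConst (ν : ℝ) (d : ℕ) : ℝ :=
  Real.log (Real.Gamma ((ν + d) / 2) / Real.Gamma (ν / 2)) - d / 2 * Real.log ((ν - 2) * Real.pi)

/-- The log-likelihood `ℓ(z)` of the Canonical-Block-t distribution as a function of the matrix `A`
(all `K²` entries of `A` being free arguments). -/
def logLik (A : Matrix (Fin K) (Fin K) ℝ) (z : (Σ k, Fin (n k)) → ℝ) : ℝ :=
  normConst (ν none) K - 1 / 2 * Real.log A.det
    - (ν none + K) / 2 * Real.log (1 + 1 / (ν none - 2) *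
        (Y0 n F z ⬝ᵥ A⁻¹ *ᵥ Y0 n F z))
    + ∑ k, (normConst (ν (some k)) (n k - 1) - 1 / 2 * ((n k : ℝ) - 1) * Real.log (lam n A k)
        - (ν (some k) + n k - 1) / 2 * Real.log (1 + 1 / (ν (some k) - 2) *
            ((Yk n F z k ⬝ᵥ Yk n F z k) * (lam n A k)⁻¹)))

/-- The log-likelihood as a function of the vector `a = vec A`. -/
def logLikVec (z : (Σ k, Fin (n k)) → ℝ) (a : Fin K × Fin K → ℝ) : ℝ :=
  logLik n F ν (unvec a) z

/-- The score `∇_A = ∂ℓ/∂vec(A)`: the vector of partial derivatives of the log-likelihood. -/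
def score (A : Matrix (Fin K) (Fin K) ℝ) (z : (Σ k, Fin (n k)) → ℝ) : Fin K × Fin K → ℝ :=
  fun p => fderiv ℝ (logLikVec n F ν z) (vec A) (Pi.single p 1)

/-- `W_0 = (ν_0 + K) / (ν_0 - 2 + X_0' X_0)`. -/
def W0 (C : Matrix (Σ k, Fin (n k)) (Σ k, Fin (n k)) ℝ) (z : (Σ k, Fin (n k)) → ℝ) : ℝ :=
  (ν none + K) / (ν none - 2 + X0 n F C z ⬝ᵥ X0 n F C z)

/-- `W_k = (ν_k + n_k - 1) / (ν_k - 2 + X_k' X_k)`. -/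
def Wk (C : Matrix (Σ k, Fin (n k)) (Σ k, Fin (n k)) ℝ) (z : (Σ k, Fin (n k)) → ℝ)
    (k : Fin K) : ℝ :=
  (ν (some k) + n k - 1) / (ν (some k) - 2 + Xk n F C z k ⬝ᵥ Xk n F C z k)

/-- `φ_0 = (ν_0 + K) / (ν_0 + K + 2)`. -/
def phi0 : ℝ := (ν none + K) / (ν none + K + 2)

/-- `φ_k = (ν_k + n_k - 1) / (ν_k + n_k + 1)`. -/
def phik (k : Fin K) : ℝ := (ν (some k) + n k - 1) / (ν (some k) + n k + 1)

/-- The vector `S`. -/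
def Svec (A : Matrix (Fin K) (Fin K) ℝ) (C : Matrix (Σ k, Fin (n k)) (Σ k, Fin (n k)) ℝ)
    (z : (Σ k, Fin (n k)) → ℝ) (k : Fin K) : ℝ :=
  1 / lam n A k - Wk n F ν C z k * (Xk n F C z k ⬝ᵥ Xk n F C z k)
    / (lam n A k * ((n k : ℝ) - 1))

/-- The diagonal matrix `Ξ`. -/
def Xi (A : Matrix (Fin K) (Fin K) ℝ) : Matrix (Fin K) (Fin K) ℝ :=
  Matrix.diagonal fun k => (phik n ν k - 1) / lam n A k ^ 2
    + 2 * phik n ν k / (lam n A k ^ 2 * ((n k : ℝ) - 1))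

end Model

end BlockCT

end

open BlockCT

/-! Everything rests on the congruence `Q' C Q = diag(A, λ_1 I, …, λ_K I)` with `Q` orthogonal.
Columns supported in one block and summing to zero are eigenvectors of `C`, and the normalized block
indicators are mixed among themselves by `A` (`blockCorr_mul_canonQ`). Uniqueness of the positive
semidefinite root gives `C^{1/2} Q = Q diag(A^{1/2}, √λ_k I)`. Hence `Z = Q (A^{1/2} V_0, √λ_1 V_1,
…)`: up to a volume-preserving rotation, `Z` is a list of independent t-vectors with scatter
matrices `A` and `λ_k I`. The density is the product of theirs (`ctStd_mul_blockDiagonal'`), and its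
logarithm is `ℓ`.

For the score, moving one entry of `A` is a rank-one perturbation, so the determinant and the
inverse are explicit in the step size (`det_add_smul_single`, `inv_add_smul_single`) and the partial
derivatives are read off (`score_apply`).

For the information, `X = Q' C^{-1/2} Z` is `V` itself (`canonical_sampleEquiv`). So the score is
half a fixed matrix applied to the statistics `W_0 vec(V_0 V_0') - vec I` and `1 - W_k V_k'V_k /
(n_k - 1)` (`score_sampleEquiv`). These are bounded, centred and, across groups, independent, so
their second-moment matrix is block diagonal and only moments within a group remain. Those come from
integration by parts against the t-kernel, whose logarithmic gradient is `-W y`. One application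
gives `E[W y_i y_j] = δ_ij`. In a second one the derivative of `W` reproduces the unknown fourth
moment with factor `-2/(ν+d)`; solving the resulting linear equation produces `φ = (ν+d)/(ν+d+2)`.
Conjugating by the fixed matrix turns the moment matrix into `I_A`. -/

noncomputable section

namespace BlockCT

/-! ### The standard multivariate t-distribution -/

/-- The unnormalized density of `t_ν^std(0, I)`. -/
def tKer {d : ℕ} (ν : ℝ) (y : Fin d → ℝ) : ℝ :=
  (1 + (y ⬝ᵥ y) / (ν - 2)) ^ (-(ν + d) / 2)

/-- The normalizing constant of `t_ν^std(0, I)`. -/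
def tConst (ν : ℝ) (d : ℕ) : ℝ :=
  Real.Gamma ((ν + d) / 2) / Real.Gamma (ν / 2) * ((ν - 2) * Real.pi) ^ (-(d : ℝ) / 2)

/-- The weight `(ν + d) / (ν - 2 + y'y)`. -/
def tWeight {d : ℕ} (ν : ℝ) (y : Fin d → ℝ) : ℝ := (ν + d) / (ν - 2 + y ⬝ᵥ y)

lemma dotProduct_self_nonneg' {d : ℕ} (y : Fin d → ℝ) : 0 ≤ y ⬝ᵥ y :=
  Finset.sum_nonneg fun i _ => mul_self_nonneg (y i)

lemma tStdDensity_one {d : ℕ} (ν : ℝ) (y : Fin d → ℝ) :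
    tStdDensity ν 1 y = tConst ν d * tKer ν y := by
  simp [tStdDensity, tConst, tKer, div_eq_inv_mul]

lemma tBase_pos {d : ℕ} {ν : ℝ} (hν : 2 < ν) (y : Fin d → ℝ) : 0 < 1 + (y ⬝ᵥ y) / (ν - 2) := by
  have := dotProduct_self_nonneg' y
  have : 0 < ν - 2 := by linarith
  positivity

lemma tDenom_pos {d : ℕ} {ν : ℝ} (hν : 2 < ν) (y : Fin d → ℝ) : 0 < ν - 2 + y ⬝ᵥ y := by
  have := dotProduct_self_nonneg' y
  linarith

lemma tKer_pos {d : ℕ} {ν : ℝ} (hν : 2 < ν) (y : Fin d → ℝ) : 0 < tKer ν y :=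
  Real.rpow_pos_of_pos (tBase_pos hν y) _

lemma tConst_pos {ν : ℝ} (hν : 2 < ν) (d : ℕ) : 0 < tConst ν d := by
  have h1 : 0 < Real.Gamma ((ν + d) / 2) := Real.Gamma_pos_of_pos (by positivity)
  have h2 : 0 < Real.Gamma (ν / 2) := Real.Gamma_pos_of_pos (by positivity)
  have h3 : 0 < ν - 2 := by linarith
  unfold tConst; positivity

lemma continuous_dotProduct_self {d : ℕ} : Continuous fun y : Fin d → ℝ => y ⬝ᵥ y := by
  unfold dotProduct; fun_prop

lemma continuous_tKer {d : ℕ} {ν : ℝ} (hν : 2 < ν) :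
    Continuous (tKer ν : (Fin d → ℝ) → ℝ) := by
  unfold tKer
  exact (continuous_const.add (continuous_dotProduct_self.div_const _)).rpow_const
    fun y => Or.inl (tBase_pos hν y).ne'

lemma continuous_tWeight {d : ℕ} {ν : ℝ} (hν : 2 < ν) :
    Continuous (tWeight ν : (Fin d → ℝ) → ℝ) := by
  unfold tWeight
  exact continuous_const.div (continuous_const.add continuous_dotProduct_self)
    fun y => (tDenom_pos hν y).ne'

/-! ### Decay and integrability of the t-kernel. -/

lemma sq_norm_le_dotProduct {d : ℕ} (y : Fin d → ℝ) : ‖y‖ ^ 2 ≤ y ⬝ᵥ y := by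
  have h : ‖y‖ ≤ √(y ⬝ᵥ y) := by
    refine (pi_norm_le_iff_of_nonneg (Real.sqrt_nonneg _)).2 fun i => ?_
    rw [Real.norm_eq_abs, ← Real.sqrt_sq_eq_abs]
    refine Real.sqrt_le_sqrt ?_
    rw [sq]
    exact Finset.single_le_sum (f := fun i => y i * y i) (fun i _ => mul_self_nonneg (y i))
      (Finset.mem_univ i)
  calc ‖y‖ ^ 2 ≤ √(y ⬝ᵥ y) ^ 2 := by gcongr
    _ = _ := Real.sq_sqrt (dotProduct_self_nonneg' y)

lemma abs_mul_le_dotProduct {d : ℕ} (y : Fin d → ℝ) (i j : Fin d) : |y i * y j| ≤ y ⬝ᵥ y := by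
  refine le_trans ?_ (sq_norm_le_dotProduct y)
  rw [abs_mul, sq]
  exact mul_le_mul (norm_le_pi_norm y i) (norm_le_pi_norm y j) (abs_nonneg _) (norm_nonneg _)

/-- The kernel decays like `(1 + ‖y‖)^(-(ν + d))`; one power is given up to accommodate test
functions of linear growth, which Stein's identity needs for `g y = y j`. -/
lemma exists_tKer_le {d : ℕ} {ν : ℝ} (hν : 2 < ν) :
    ∃ c, ∀ y : Fin d → ℝ, tKer ν y * (1 + ‖y‖) ≤ c * (1 + ‖y‖) ^ (-(ν + d - 1)) := by
  have hν2 : 0 < ν - 2 := by linarith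
  -- The 2 comes from `(1 + r)² ≤ 2 (1 + r²)`, the maximum from comparing `1 + y'y` with `1 + y'y /
  -- (ν - 2)`.
  set m := 2 * max 1 (ν - 2) with hm
  have hm0 : 0 < m := by positivity
  refine ⟨m ^ ((ν + d) / 2), fun y => ?_⟩
  have hy : 0 < 1 + ‖y‖ := by positivity
  have hb := tBase_pos hν y
  have h1 : (1 + ‖y‖) ^ 2 ≤ m * (1 + (y ⬝ᵥ y) / (ν - 2)) := by
    have h2 := sq_norm_le_dotProduct y
    have h3 : y ⬝ᵥ y ≤ max 1 (ν - 2) * ((y ⬝ᵥ y) / (ν - 2)) := by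
      calc y ⬝ᵥ y = (ν - 2) * ((y ⬝ᵥ y) / (ν - 2)) := by field_simp
        _ ≤ _ := by
          have := dotProduct_self_nonneg' y
          gcongr; exact le_max_right _ _
    have h4 : (1 : ℝ) ≤ max 1 (ν - 2) := le_max_left _ _
    nlinarith [sq_nonneg (1 - ‖y‖)]
  have h5 : tKer ν y ≤ m ^ ((ν + d) / 2) * (1 + ‖y‖) ^ (-(ν + d)) := by
    unfold tKer
    have e1 : (1 + ‖y‖) ^ (-(ν + d)) = ((1 + ‖y‖) ^ 2) ^ (-(ν + d) / 2) := by
      rw [← Real.rpow_natCast, ← Real.rpow_mul hy.le]; congr 1; push_cast; ring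
    have e2 : m ^ ((ν + d) / 2) * m ^ (-(ν + d) / 2) = 1 := by
      rw [← Real.rpow_add hm0]; convert Real.rpow_zero m using 2; ring
    rw [e1]
    have h6 : (m * (1 + (y ⬝ᵥ y) / (ν - 2))) ^ (-(ν + d) / 2) ≤
        ((1 + ‖y‖) ^ 2) ^ (-(ν + d) / 2) := by
      refine Real.rpow_le_rpow_of_nonpos (by positivity) h1 ?_
      have : (0 : ℝ) ≤ d := by positivity
      linarith
    rw [Real.mul_rpow hm0.le hb.le] at h6
    calc _ = (m ^ ((ν + d) / 2) * m ^ (-(ν + d) / 2)) *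
          (1 + (y ⬝ᵥ y) / (ν - 2)) ^ (-(ν + d) / 2) := by rw [e2, one_mul]
      _ ≤ _ := by rw [mul_assoc]; gcongr
  calc tKer ν y * (1 + ‖y‖) ≤ m ^ ((ν + d) / 2) * (1 + ‖y‖) ^ (-(ν + d)) * (1 + ‖y‖) := by gcongr
    _ = m ^ ((ν + d) / 2) * ((1 + ‖y‖) ^ (-(ν + d)) * (1 + ‖y‖) ^ (1 : ℝ)) := by
      rw [Real.rpow_one]; ring
    _ = _ := by rw [← Real.rpow_add hy]; congr 2; ring

/-- Functions of at most linear growth are integrable against the t-density. -/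
lemma integrable_tKer_mul {d : ℕ} {ν : ℝ} (hν : 2 < ν) {g : (Fin d → ℝ) → ℝ}
    (hg : Continuous g) {c : ℝ} (hc : ∀ y, |g y| ≤ c * (1 + ‖y‖)) :
    Integrable (fun y => tKer ν y * g y) := by
  obtain ⟨m, hm⟩ := exists_tKer_le (d := d) hν
  have hc0 : 0 ≤ c := by
    have := (abs_nonneg _).trans (hc 0)
    simpa using this
  -- Integrability needs `ν + d - 1 > d`, which holds as `ν > 2`.
  have hi : Integrable (fun y : Fin d → ℝ => c * (m * (1 + ‖y‖) ^ (-(ν + d - 1)))) :=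
    ((integrable_one_add_norm (by simp; linarith)).const_mul m).const_mul c
  refine hi.mono' ((continuous_tKer hν).mul hg).aestronglyMeasurable (.of_forall fun y => ?_)
  rw [Real.norm_eq_abs, abs_mul, abs_of_pos (tKer_pos hν y)]
  calc tKer ν y * |g y| ≤ tKer ν y * (c * (1 + ‖y‖)) := by
        have := (tKer_pos hν y).le
        gcongr; exact hc y
    _ = c * (tKer ν y * (1 + ‖y‖)) := by ring
    _ ≤ _ := mul_le_mul_of_nonneg_left (hm y) hc0

/-! ### Integration by parts and weighted moments of the kernel. -/

lemma hasDerivAt_dotProduct_line {d : ℕ} (y : Fin d → ℝ) (i : Fin d) :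
    HasDerivAt (fun t : ℝ => (y + t • Pi.single i 1) ⬝ᵥ (y + t • Pi.single i 1)) (2 * y i) 0 := by
  have h : (fun t : ℝ => (y + t • (Pi.single i 1 : Fin d → ℝ)) ⬝ᵥ (y + t • Pi.single i 1)) =
      fun t => y ⬝ᵥ y + 2 * y i * t + t ^ 2 := by
    ext t
    simp [add_dotProduct, dotProduct_add]
    ring
  rw [h]
  have := (((hasDerivAt_id (0 : ℝ)).const_mul (2 * y i)).const_add (y ⬝ᵥ y)).fun_add
    (hasDerivAt_pow 2 (0 : ℝ))
  simpa [Function.comp_def] using this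

/-- The weight is the factor in the logarithmic gradient `-W y` of the kernel, which is why weighted
moments are the ones computable by parts. -/
lemma hasLineDerivAt_tKer {d : ℕ} {ν : ℝ} (hν : 2 < ν) (y : Fin d → ℝ) (i : Fin d) :
    HasLineDerivAt ℝ (tKer ν) (-(tWeight ν y * y i) * tKer ν y) y (Pi.single i 1) := by
  unfold HasLineDerivAt tKer
  have hb := tBase_pos hν y
  have h := (((hasDerivAt_dotProduct_line y i).div_const (ν - 2)).const_add 1).rpow_const
    (p := -(ν + d) / 2) (Or.inl (by simpa using hb.ne'))
  refine h.congr_deriv ?_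
  simp only [zero_smul, add_zero]
  rw [Real.rpow_sub_one hb.ne']
  have h2 : ν - 2 ≠ 0 := by linarith
  have h3 := (tDenom_pos hν y).ne'
  have h4 : 1 + (y ⬝ᵥ y) / (ν - 2) = (ν - 2 + y ⬝ᵥ y) / (ν - 2) := by field_simp
  unfold tWeight
  rw [h4]
  field_simp

/-- The denominator of the weight dominates `y'y ≥ |y i * y j|`. Weighted quadratic statistics are
thus bounded, and all their moments exist without further conditions on `ν`. -/
lemma tWeight_mul_abs_le {d : ℕ} {ν : ℝ} (hν : 2 < ν) (y : Fin d → ℝ) (i j : Fin d) :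
    |tWeight ν y * (y i * y j)| ≤ ν + d := by
  have h := tDenom_pos hν y
  have hd : 0 < ν + d := by positivity
  rw [abs_mul, tWeight, abs_of_pos (by positivity), div_mul_eq_mul_div, div_le_iff₀ h]
  have := abs_mul_le_dotProduct y i j
  gcongr; linarith

/-- Stein's identity for the t-density: integration by parts in the `i`-th coordinate. -/
lemma integral_tKer_mul_lineDeriv {d : ℕ} {ν : ℝ} (hν : 2 < ν) (i : Fin d)
    {g g' : (Fin d → ℝ) → ℝ} (hg : Continuous g) (hg' : Continuous g')
    (hd : ∀ y, HasLineDerivAt ℝ g (g' y) y (Pi.single i 1)) {c : ℝ}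
    (hc : ∀ y, |g y| ≤ c * (1 + ‖y‖)) (hc' : ∀ y, |g' y| ≤ c)
    (hcw : ∀ y, |tWeight ν y * (y i * g y)| ≤ c) :
    ∫ y, tKer ν y * g' y = ∫ y, tKer ν y * (tWeight ν y * (y i * g y)) := by
  have hlin : ∀ {x : ℝ} (y : Fin d → ℝ), |x| ≤ c → |x| ≤ c * (1 + ‖y‖) := fun {x} y hx => by
    have : 0 ≤ c := (abs_nonneg x).trans hx
    nlinarith [norm_nonneg y]
  have hw : Continuous fun y : Fin d → ℝ => tWeight ν y * (y i * g y) :=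
    (continuous_tWeight hν).mul ((continuous_apply i).mul hg)
  have key := integral_bilinear_hasLineDerivAt_right_eq_neg_left_of_integrable
    (μ := (volume : Measure (Fin d → ℝ))) (f := tKer ν)
    (f' := fun y => -(tWeight ν y * y i) * tKer ν y) (g := g) (g' := g') (v := Pi.single i 1)
    (B := ContinuousLinearMap.mul ℝ ℝ) ?_ ?_ ?_
    (fun y _ => hasLineDerivAt_tKer hν y i) (fun y _ => hd y)
  · simp only [ContinuousLinearMap.mul_apply'] at key
    rw [key, ← integral_neg]
    congr 1; ext y; ring
  · have := (integrable_tKer_mul hν hw fun y => hlin y (hcw y)).neg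
    refine this.congr (.of_forall fun y => ?_)
    simp; ring
  · exact integrable_tKer_mul hν hg' fun y => hlin y (hc' y)
  · exact integrable_tKer_mul hν hg hc

lemma hasLineDerivAt_coord {d : ℕ} (y : Fin d → ℝ) (i j : Fin d) :
    HasLineDerivAt ℝ (fun y : Fin d → ℝ => y j) (if i = j then 1 else 0) y (Pi.single i 1) := by
  have := (ContinuousLinearMap.proj (R := ℝ) (φ := fun _ : Fin d => ℝ) j).hasFDerivAt (x := y)
  have h2 := this.hasLineDerivAt (Pi.single i 1)
  have h3 : (ContinuousLinearMap.proj (R := ℝ) (φ := fun _ : Fin d => ℝ) j) (Pi.single i 1) =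
      if i = j then 1 else 0 := by simp [Pi.single_apply, eq_comm]
  rw [h3] at h2
  exact h2

/-- Stein's identity with `g y = y j`, whose derivative in direction `i` is the constant `δ_ij`. -/
lemma integral_tKer_weight_two {d : ℕ} {ν : ℝ} (hν : 2 < ν) (i j : Fin d) :
    ∫ y : Fin d → ℝ, tKer ν y * (tWeight ν y * (y i * y j)) =
      (if i = j then 1 else 0) * ∫ y : Fin d → ℝ, tKer ν y := by
  have hνd : 1 ≤ ν + d := by have : (0 : ℝ) ≤ d := by positivity
                             linarith
  rw [← integral_tKer_mul_lineDeriv hν i (continuous_apply j)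
    (g' := fun _ => if i = j then 1 else 0) continuous_const
    (fun y => hasLineDerivAt_coord y i j) (c := ν + d) ?_ ?_ ?_, integral_mul_const, mul_comm]
  · intro y
    have := norm_le_pi_norm y j
    rw [Real.norm_eq_abs] at this
    nlinarith [norm_nonneg y]
  · intro y; split_ifs <;> simp <;> linarith
  · exact fun y => tWeight_mul_abs_le hν y i j

/-- Differentiating `W` returns `W²` times a coordinate, so the fourth-moment recursion closes on
itself. -/
lemma hasLineDerivAt_tWeight {d : ℕ} {ν : ℝ} (hν : 2 < ν) (y : Fin d → ℝ) (i : Fin d) :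
    HasLineDerivAt ℝ (tWeight ν) (-(2 / (ν + d) * (tWeight ν y ^ 2 * y i))) y (Pi.single i 1) := by
  unfold HasLineDerivAt tWeight
  have hb := tDenom_pos hν y
  have h := (hasDerivAt_const (0 : ℝ) (ν + d)).div
    ((hasDerivAt_dotProduct_line y i).const_add (ν - 2)) (by simpa using hb.ne')
  refine h.congr_deriv ?_
  have : 0 < ν + d := by positivity
  simp only [zero_smul, add_zero]
  field_simp
  ring

/-- The fourth-order moments of the weighted t-distribution. -/
lemma integral_tKer_weight_four {d : ℕ} {ν : ℝ} (hν : 2 < ν) (i j k l : Fin d) :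
    ∫ y : Fin d → ℝ, tKer ν y * (tWeight ν y * (y i * y j) * (tWeight ν y * (y k * y l))) =
      (ν + d) / (ν + d + 2) * ((if i = j then 1 else 0) * (if k = l then 1 else 0)
        + (if i = k then 1 else 0) * (if j = l then 1 else 0)
        + (if i = l then 1 else 0) * (if j = k then 1 else 0)) * ∫ y : Fin d → ℝ, tKer ν y := by
  have hνd : 0 < ν + d := by positivity
  -- The derivative in direction `i` of `g y = y j * (W y k y l)`. The last term, from
  -- differentiating `W`, is a multiple of the integrand being computed.
  set g' : (Fin d → ℝ) → ℝ := fun y =>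
    (if i = j then 1 else 0) * (tWeight ν y * (y k * y l))
    + (if i = k then 1 else 0) * (tWeight ν y * (y j * y l))
    + (if i = l then 1 else 0) * (tWeight ν y * (y j * y k))
    - 2 / (ν + d) * (tWeight ν y * (y i * y j) * (tWeight ν y * (y k * y l))) with hg'
  have hW := continuous_tWeight (d := d) hν
  have hq : ∀ a b : Fin d, Continuous fun y : Fin d → ℝ => tWeight ν y * (y a * y b) :=
    fun a b => hW.mul ((continuous_apply a).mul (continuous_apply b))
  have hbd : ∀ a b (y : Fin d → ℝ), |tWeight ν y * (y a * y b)| ≤ ν + d :=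
    fun a b y => tWeight_mul_abs_le hν y a b
  have hbd4 : ∀ y : Fin d → ℝ,
      |tWeight ν y * (y i * y j) * (tWeight ν y * (y k * y l))| ≤ (ν + d) * (ν + d) := fun y => by
    rw [abs_mul]; exact mul_le_mul (hbd _ _ y) (hbd _ _ y) (abs_nonneg _) hνd.le
  have hδ : ∀ (a b : Fin d) {x : ℝ}, |x| ≤ ν + d → |(if a = b then 1 else 0) * x| ≤ ν + d := by
    intro a b x hx; split_ifs <;> simp [hx, hνd.le]
  have hint : ∀ {f : (Fin d → ℝ) → ℝ} {c : ℝ}, Continuous f → (∀ y, |f y| ≤ c) →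
      Integrable fun y => tKer ν y * f y := fun {f c} hf hc => by
    refine integrable_tKer_mul hν hf (c := c) fun y => (hc y).trans ?_
    have : 0 ≤ c := (abs_nonneg _).trans (hc 0)
    nlinarith [norm_nonneg y]
  -- One constant serves all three bounds: `3(ν+d) + 2(ν+d)` for the four terms of `g'`, `(ν+d)²`
  -- for `W y_i g`; and `|g| ≤ (ν+d)‖y‖`.
  have key := integral_tKer_mul_lineDeriv hν i
    (g := fun y => y j * (tWeight ν y * (y k * y l))) (g' := g')
    ((continuous_apply j).mul (hq k l)) (by
      have := hq i j; have := hq k l; have := hq j l; have := hq j k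
      fun_prop) ?_ (c := 3 * (ν + d) + 2 * (ν + d) + (ν + d) * (ν + d)) ?_ ?_ ?_
  · have e1 : ∫ y, tKer ν y * g' y =
        ((if i = j then 1 else 0) * (if k = l then 1 else 0)
        + (if i = k then 1 else 0) * (if j = l then 1 else 0)
        + (if i = l then 1 else 0) * (if j = k then 1 else 0)) * (∫ y : Fin d → ℝ, tKer ν y)
        - 2 / (ν + d) * ∫ y : Fin d → ℝ,
          tKer ν y * (tWeight ν y * (y i * y j) * (tWeight ν y * (y k * y l))) := by
      have s : ∀ y, tKer ν y * g' y =
          (if i = j then 1 else 0) * (tKer ν y * (tWeight ν y * (y k * y l)))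
          + (if i = k then 1 else 0) * (tKer ν y * (tWeight ν y * (y j * y l)))
          + (if i = l then 1 else 0) * (tKer ν y * (tWeight ν y * (y j * y k)))
          - 2 / (ν + d) * (tKer ν y *
            (tWeight ν y * (y i * y j) * (tWeight ν y * (y k * y l)))) := fun y => by
        simp only [hg']; ring
      simp_rw [s]
      have i1 := (hint (hq k l) (hbd k l)).const_mul (if i = j then 1 else 0)
      have i2 := (hint (hq j l) (hbd j l)).const_mul (if i = k then 1 else 0)
      have i3 := (hint (hq j k) (hbd j k)).const_mul (if i = l then 1 else 0)
      have i4 := (hint ((hq i j).fun_mul (hq k l)) hbd4).const_mul (2 / (ν + d))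
      rw [integral_sub ((i1.fun_add i2).fun_add i3) i4, integral_add (i1.fun_add i2) i3, integral_add i1 i2]
      simp only [integral_const_mul, integral_tKer_weight_two hν]
      ring
    rw [e1] at key
    have e2 : ∀ y : Fin d → ℝ, tKer ν y * (tWeight ν y * (y i * (y j * (tWeight ν y * (y k * y l)))))
        = tKer ν y * (tWeight ν y * (y i * y j) * (tWeight ν y * (y k * y l))) := fun y => by ring
    simp_rw [e2] at key
    have h2 : ν + d + 2 ≠ 0 := by positivity
    generalize (∫ y : Fin d → ℝ,
      tKer ν y * (tWeight ν y * (y i * y j) * (tWeight ν y * (y k * y l)))) = I at key ⊢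
    -- `key` reads `D - 2/(ν+d) * I = I`, with `D` the sum of delta products times the mass of the
    -- kernel; it is solved for `I`.
    field_simp at key ⊢
    linarith
  · intro y
    have hc := fun a => hasLineDerivAt_coord y i a
    have hw := hasLineDerivAt_tWeight hν y i
    unfold HasLineDerivAt at hc hw ⊢
    have := (hc j).mul (hw.mul ((hc k).mul (hc l)))
    refine this.congr_deriv ?_
    simp only [hg', Pi.mul_apply, zero_smul, add_zero]
    split_ifs <;> ring
  · intro y
    have h1 := norm_le_pi_norm y j
    rw [Real.norm_eq_abs] at h1
    rw [abs_mul]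
    have h2 := hbd k l y
    have : |y j| * |tWeight ν y * (y k * y l)| ≤ ‖y‖ * (ν + d) :=
      mul_le_mul h1 h2 (abs_nonneg _) (norm_nonneg _)
    nlinarith [norm_nonneg y, mul_nonneg hνd.le hνd.le, mul_nonneg (norm_nonneg y) hνd.le,
      mul_nonneg (norm_nonneg y) (mul_nonneg hνd.le hνd.le)]
  · intro y
    have h1 := hδ i j (hbd k l y)
    have h2 := hδ i k (hbd j l y)
    have h3 := hδ i l (hbd j k y)
    have h4 : |2 / (ν + d) * (tWeight ν y * (y i * y j) * (tWeight ν y * (y k * y l)))| ≤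
        2 * (ν + d) := by
      rw [abs_mul, abs_of_pos (by positivity)]
      calc _ ≤ 2 / (ν + d) * ((ν + d) * (ν + d)) := by gcongr; exact hbd4 y
        _ = _ := by field_simp
    simp only [hg']
    rw [abs_le] at *
    constructor <;> nlinarith [mul_nonneg hνd.le hνd.le]
  · intro y
    have := hbd4 y
    rw [show tWeight ν y * (y i * (y j * (tWeight ν y * (y k * y l)))) =
      tWeight ν y * (y i * y j) * (tWeight ν y * (y k * y l)) by ring]
    nlinarith

/-! ### The normalizing constant. -/

lemma lintegral_gamma_kernel {a r : ℝ} (ha : 0 < a) (hr : 0 < r) :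
    ∫⁻ t in Set.Ioi (0 : ℝ), ENNReal.ofReal (t ^ (a - 1) * Real.exp (-(r * t))) =
      ENNReal.ofReal ((1 / r) ^ a * Real.Gamma a) := by
  have h := Real.integral_rpow_mul_exp_neg_mul_Ioi ha hr
  have hpos : 0 < (1 / r) ^ a * Real.Gamma a := by
    have := Real.Gamma_pos_of_pos ha
    positivity
  rw [← h, ofReal_integral_eq_lintegral_ofReal]
  · refine Integrable.of_integral_ne_zero ?_
    rw [h]; exact hpos.ne'
  · refine (ae_restrict_mem measurableSet_Ioi).mono fun t ht => ?_
    have : 0 < t := ht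
    simp only [Pi.zero_apply]; positivity

lemma lintegral_gaussian_pi {d : ℕ} {s : ℝ} (hs : 0 < s) :
    ∫⁻ y : Fin d → ℝ, ENNReal.ofReal (Real.exp (-s * (y ⬝ᵥ y))) =
      ENNReal.ofReal ((Real.pi / s) ^ ((d : ℝ) / 2)) := by
  have e : ∀ y : Fin d → ℝ, Real.exp (-s * (y ⬝ᵥ y)) = ∏ i, Real.exp (-s * y i ^ 2) := fun y => by
    rw [← Real.exp_sum, ← Finset.mul_sum]
    simp [dotProduct, sq]
  simp_rw [e]
  have hi : Integrable (fun y : Fin d → ℝ => ∏ i, Real.exp (-s * y i ^ 2)) volume :=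
    Integrable.fintype_prod (f := fun _ : Fin d => fun x : ℝ => Real.exp (-s * x ^ 2))
      fun _ => integrable_exp_neg_mul_sq hs
  rw [← ofReal_integral_eq_lintegral_ofReal hi
    (.of_forall fun y => Finset.prod_nonneg fun i _ => (Real.exp_pos _).le),
    integral_fintype_prod_volume_eq_pow (fun x : ℝ => Real.exp (-s * x ^ 2)), integral_gaussian,
    Fintype.card_fin, Real.sqrt_eq_rpow, ← Real.rpow_natCast, ← Real.rpow_mul (by positivity)]
  congr 2; ring

/-- The t-kernel is a Gamma mixture of Gaussians: `Γ(a) b^(-a) = ∫ t^(a-1) e^(-bt) dt` with `b = 1 +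
y'y/(ν-2)`. Tonelli lets `y` be integrated first, leaving a Gamma integral in `t`. -/
lemma lintegral_tKer {d : ℕ} {ν : ℝ} (hν : 2 < ν) :
    ∫⁻ y : Fin d → ℝ, ENNReal.ofReal (Real.Gamma ((ν + d) / 2) * tKer ν y) =
      ENNReal.ofReal (((ν - 2) * Real.pi) ^ ((d : ℝ) / 2) * Real.Gamma (ν / 2)) := by
  have hb : 0 < ν - 2 := by linarith
  have ha : 0 < (ν + d) / 2 := by positivity
  have h1 : ∀ y : Fin d → ℝ, ENNReal.ofReal (Real.Gamma ((ν + d) / 2) * tKer ν y) =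
      ∫⁻ t in Set.Ioi (0 : ℝ), ENNReal.ofReal (t ^ ((ν + d) / 2 - 1) *
        Real.exp (-((1 + (y ⬝ᵥ y) / (ν - 2)) * t))) := fun y => by
    rw [lintegral_gamma_kernel ha (tBase_pos hν y), mul_comm, tKer, one_div,
      Real.inv_rpow (tBase_pos hν y).le, ← Real.rpow_neg (tBase_pos hν y).le]
    congr 3; ring
  simp_rw [h1]
  rw [lintegral_lintegral_swap]
  swap
  · refine Measurable.aemeasurable ?_
    refine ENNReal.measurable_ofReal.comp ?_
    have := (continuous_dotProduct_self (d := d)).measurable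
    have h2 : Measurable fun p : (Fin d → ℝ) × ℝ => p.1 ⬝ᵥ p.1 := this.comp measurable_fst
    fun_prop
  have h2 : ∀ t ∈ Set.Ioi (0 : ℝ), ∫⁻ y : Fin d → ℝ, ENNReal.ofReal (t ^ ((ν + d) / 2 - 1) *
        Real.exp (-((1 + (y ⬝ᵥ y) / (ν - 2)) * t))) =
      ENNReal.ofReal (((ν - 2) * Real.pi) ^ ((d : ℝ) / 2)) *
        ENNReal.ofReal (t ^ (ν / 2 - 1) * Real.exp (-(1 * t))) := fun t ht => by
    have ht0 : 0 < t := ht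
    have e : ∀ y : Fin d → ℝ, ENNReal.ofReal (t ^ ((ν + d) / 2 - 1) *
        Real.exp (-((1 + (y ⬝ᵥ y) / (ν - 2)) * t))) =
        ENNReal.ofReal (t ^ ((ν + d) / 2 - 1) * Real.exp (-(1 * t))) *
          ENNReal.ofReal (Real.exp (-(t / (ν - 2)) * (y ⬝ᵥ y))) := fun y => by
      rw [← ENNReal.ofReal_mul (by positivity), mul_assoc, ← Real.exp_add]
      congr 3; field_simp; ring
    simp_rw [e]
    rw [lintegral_const_mul' _ _ ENNReal.ofReal_ne_top, lintegral_gaussian_pi (by positivity),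
      ← ENNReal.ofReal_mul (by positivity), ← ENNReal.ofReal_mul (by positivity)]
    congr 1
    have e1 : Real.pi / (t / (ν - 2)) = (ν - 2) * Real.pi / t := by field_simp
    -- The Gaussian integral contributes `t^(-d/2)`, lowering the Gamma shape from `(ν+d)/2` to
    -- `ν/2`.
    have e2 : t ^ ((ν + d) / 2 - 1) = t ^ (ν / 2 - 1) * t ^ ((d : ℝ) / 2) := by
      rw [← Real.rpow_add ht0]; congr 1; ring
    rw [e1, Real.div_rpow (by positivity) ht0.le, e2]
    field_simp
  rw [setLIntegral_congr_fun measurableSet_Ioi h2, lintegral_const_mul' _ _ ENNReal.ofReal_ne_top,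
    lintegral_gamma_kernel (by positivity) one_pos, ← ENNReal.ofReal_mul (by positivity)]
  simp

lemma lintegral_tStdDensity_one {d : ℕ} {ν : ℝ} (hν : 2 < ν) :
    ∫⁻ y : Fin d → ℝ, ENNReal.ofReal (tStdDensity ν 1 y) = 1 := by
  have hb : 0 < ν - 2 := by linarith
  have h1 : 0 < Real.Gamma ((ν + d) / 2) := Real.Gamma_pos_of_pos (by positivity)
  have h2 : 0 < Real.Gamma (ν / 2) := Real.Gamma_pos_of_pos (by positivity)
  have e : ∀ y : Fin d → ℝ, ENNReal.ofReal (tStdDensity ν 1 y) =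
      ENNReal.ofReal (tConst ν d / Real.Gamma ((ν + d) / 2)) *
        ENNReal.ofReal (Real.Gamma ((ν + d) / 2) * tKer ν y) := fun y => by
    rw [← ENNReal.ofReal_mul (div_nonneg (tConst_pos hν d).le h1.le), tStdDensity_one]
    congr 1; field_simp
  simp_rw [e]
  rw [lintegral_const_mul' _ _ ENNReal.ofReal_ne_top, lintegral_tKer hν,
    ← ENNReal.ofReal_mul (div_nonneg (tConst_pos hν d).le h1.le), tConst,
    show -(d : ℝ) / 2 = -((d : ℝ) / 2) by ring, Real.rpow_neg (by positivity),
    ← ENNReal.ofReal_one]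
  congr 1
  have h3 : ((ν - 2) * Real.pi) ^ ((d : ℝ) / 2) ≠ 0 := by positivity
  field_simp

/-! ### Expectations under the standard t-distribution. -/

lemma isProbabilityMeasure_tStd_one {d : ℕ} {ν : ℝ} (hν : 2 < ν) :
    IsProbabilityMeasure (tStd ν (1 : Matrix (Fin d) (Fin d) ℝ)) :=
  ⟨by rw [tStd, withDensity_apply _ MeasurableSet.univ, Measure.restrict_univ,
    lintegral_tStdDensity_one hν]⟩

lemma integral_tStd_one {d : ℕ} {ν : ℝ} (hν : 2 < ν) (g : (Fin d → ℝ) → ℝ) :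
    ∫ y, g y ∂tStd ν 1 = tConst ν d * ∫ y, tKer ν y * g y := by
  have hm : Measurable fun y : Fin d → ℝ => ENNReal.ofReal (tStdDensity ν 1 y) := by
    simp_rw [tStdDensity_one]
    exact ((continuous_tKer hν).const_mul _).measurable.ennreal_ofReal
  rw [tStd, integral_withDensity_eq_integral_toReal_smul hm
    (.of_forall fun y => ENNReal.ofReal_lt_top), ← integral_const_mul]
  congr 1; ext y
  rw [tStdDensity_one, ENNReal.toReal_ofReal (mul_pos (tConst_pos hν d) (tKer_pos hν y)).le,
    smul_eq_mul, mul_assoc]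

lemma tConst_mul_integral_tKer {d : ℕ} {ν : ℝ} (hν : 2 < ν) :
    tConst ν d * ∫ y : Fin d → ℝ, tKer ν y = 1 := by
  have := isProbabilityMeasure_tStd_one (d := d) hν
  have h := integral_tStd_one (d := d) hν fun _ => 1
  simpa using h.symm

/-- The second-order weighted moments of the standard t-distribution. -/
lemma integral_tStd_weight_two {d : ℕ} {ν : ℝ} (hν : 2 < ν) (i j : Fin d) :
    ∫ y, tWeight ν y * (y i * y j) ∂tStd ν (1 : Matrix (Fin d) (Fin d) ℝ) =
      if i = j then 1 else 0 := by
  rw [integral_tStd_one hν, integral_tKer_weight_two hν, mul_left_comm,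
    tConst_mul_integral_tKer hν, mul_one]

/-- The fourth-order weighted moments of the standard t-distribution. -/
lemma integral_tStd_weight_four {d : ℕ} {ν : ℝ} (hν : 2 < ν) (i j k l : Fin d) :
    ∫ y, tWeight ν y * (y i * y j) * (tWeight ν y * (y k * y l))
        ∂tStd ν (1 : Matrix (Fin d) (Fin d) ℝ) =
      (ν + d) / (ν + d + 2) * ((if i = j then 1 else 0) * (if k = l then 1 else 0)
        + (if i = k then 1 else 0) * (if j = l then 1 else 0)
        + (if i = l then 1 else 0) * (if j = k then 1 else 0)) := by
  rw [integral_tStd_one hν, integral_tKer_weight_four hν, mul_left_comm,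
    tConst_mul_integral_tKer hν, mul_one]

lemma integrable_tStd_of_bound {d : ℕ} {ν : ℝ} (hν : 2 < ν) {g : (Fin d → ℝ) → ℝ}
    (hg : Continuous g) {c : ℝ} (hc : ∀ y, |g y| ≤ c) :
    Integrable g (tStd ν (1 : Matrix (Fin d) (Fin d) ℝ)) := by
  have := isProbabilityMeasure_tStd_one (d := d) hν
  exact Integrable.of_bound hg.aestronglyMeasurable c (.of_forall hc)

/-! ### Linear images -/

/-- A measurable equivalence transports densities. -/
lemma map_withDensity_equiv {α β : Type*} [MeasurableSpace α] [MeasurableSpace β]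
    (μ : Measure α) (e : α ≃ᵐ β) (f : α → ENNReal) :
    (μ.withDensity f).map e = (μ.map e).withDensity (f ∘ e.symm) := by
  ext s hs
  rw [e.map_apply, withDensity_apply _ (e.measurable hs), withDensity_apply _ hs,
    e.measurableEmbedding.restrict_map, lintegral_map_equiv]
  simp

/-- A finite product of probability densities is the density of the product measure. -/
lemma pi_withDensity_volume {G : Type*} [Fintype G] {m : G → ℕ}
    {f : ∀ g, (Fin (m g) → ℝ) → ℝ} (hf : ∀ g, Measurable (f g)) (hf0 : ∀ g y, 0 ≤ f g y)
    [∀ g, IsProbabilityMeasure (volume.withDensity fun y => ENNReal.ofReal (f g y))] :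
    Measure.pi (fun g => volume.withDensity fun y => ENNReal.ofReal (f g y)) =
      (volume : Measure (∀ g, Fin (m g) → ℝ)).withDensity
        fun V => ENNReal.ofReal (∏ g, f g (V g)) := by
  -- Total mass one makes each factor integrable, so that the integral of the product over a box
  -- factorizes.
  have hint : ∀ g, Integrable (f g) := fun g => by
    refine (lintegral_ofReal_ne_top_iff_integrable (hf g).aestronglyMeasurable
      (.of_forall (hf0 g))).1 ?_
    have h := measure_univ (μ := volume.withDensity fun y => ENNReal.ofReal (f g y))
    rw [withDensity_apply _ MeasurableSet.univ, Measure.restrict_univ] at h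
    rw [h]; exact ENNReal.one_ne_top
  refine Measure.pi_eq fun s hs => ?_
  rw [withDensity_apply _ (MeasurableSet.univ_pi hs), ← lintegral_indicator (MeasurableSet.univ_pi hs)]
  have e : (Set.univ.pi s).indicator (fun V : ∀ g, Fin (m g) → ℝ => ENNReal.ofReal (∏ g, f g (V g)))
      = fun V => ENNReal.ofReal (∏ g, (s g).indicator (f g) (V g)) := by
    ext V
    by_cases hV : V ∈ Set.univ.pi s
    · rw [Set.indicator_of_mem hV]
      congr 1
      exact Finset.prod_congr rfl fun g _ => (Set.indicator_of_mem (hV g trivial) _).symm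
    · rw [Set.indicator_of_notMem hV]
      simp only [Set.mem_pi, Set.mem_univ, true_implies, not_forall] at hV
      obtain ⟨g, hg⟩ := hV
      rw [Finset.prod_eq_zero (Finset.mem_univ g) (Set.indicator_of_notMem hg _),
        ENNReal.ofReal_zero]
  have h0 : ∀ g y, 0 ≤ (s g).indicator (f g) y :=
    fun g y => Set.indicator_nonneg (fun y _ => hf0 g y) y
  have hi : Integrable (fun V : ∀ g, Fin (m g) → ℝ => ∏ g, (s g).indicator (f g) (V g)) volume :=
    Integrable.fintype_prod_dep fun g => (hint g).indicator (hs g)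
  rw [e, ← ofReal_integral_eq_lintegral_ofReal hi
    (.of_forall fun V => Finset.prod_nonneg fun g _ => h0 g _),
    integral_fintype_prod_volume_eq_prod, ENNReal.ofReal_prod_of_nonneg
      fun g _ => integral_nonneg (h0 g)]
  refine Finset.prod_congr rfl fun g _ => ?_
  rw [withDensity_apply _ (hs g), ← lintegral_indicator (hs g),
    ofReal_integral_eq_lintegral_ofReal ((hint g).indicator (hs g)) (.of_forall (h0 g))]
  congr 1; ext y
  by_cases hy : y ∈ s g <;> simp [hy]

/-- The measurable equivalence `v ↦ B v` for an invertible matrix with inverse `B'`. -/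
def mulVecEquiv {M N : Type*} [Fintype M] [Fintype N] [DecidableEq M] [DecidableEq N]
    (B : Matrix N M ℝ) (B' : Matrix M N ℝ) (h : B * B' = 1) (h' : B' * B = 1) :
    (M → ℝ) ≃ᵐ (N → ℝ) where
  toFun v := B *ᵥ v
  invFun v := B' *ᵥ v
  left_inv v := by simp [h']
  right_inv v := by simp [h]
  measurable_toFun := (Continuous.matrix_mulVec continuous_const continuous_id).measurable
  measurable_invFun := (Continuous.matrix_mulVec continuous_const continuous_id).measurable

lemma tStdDensity_nonneg {d : ℕ} {ν : ℝ} (hν : 2 < ν) {S : Matrix (Fin d) (Fin d) ℝ}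
    (hS : S.PosDef) (y : Fin d → ℝ) : 0 ≤ tStdDensity ν S y := by
  have h1 := (tConst_pos hν d).le
  unfold tConst at h1
  have h2 : 0 ≤ y ⬝ᵥ S⁻¹ *ᵥ y := by simpa using hS.inv.posSemidef.dotProduct_mulVec_nonneg y
  have h3 := hS.det_pos.le
  have h4 : 0 < ν - 2 := by linarith
  unfold tStdDensity
  positivity

lemma continuous_tStdDensity {d : ℕ} {ν : ℝ} (hν : 2 < ν) {S : Matrix (Fin d) (Fin d) ℝ}
    (hS : S.PosDef) : Continuous (tStdDensity ν S) := by
  unfold tStdDensity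
  have hq : Continuous fun y : Fin d → ℝ => y ⬝ᵥ S⁻¹ *ᵥ y :=
    continuous_id.dotProduct (Continuous.matrix_mulVec continuous_const continuous_id)
  refine continuous_const.mul ((continuous_const.add (continuous_const.mul hq)).rpow_const
    fun y => Or.inl ?_)
  have h2 : 0 ≤ y ⬝ᵥ S⁻¹ *ᵥ y := by simpa using hS.inv.posSemidef.dotProduct_mulVec_nonneg y
  have h4 : 0 < ν - 2 := by linarith
  have h5 : 0 ≤ 1 / (ν - 2) * (y ⬝ᵥ S⁻¹ *ᵥ y) := by positivity
  exact (by linarith : 0 < 1 + 1 / (ν - 2) * (y ⬝ᵥ S⁻¹ *ᵥ y)).ne'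

/-- With `Σ = R R` and `R` symmetric, `y'Σ⁻¹y = |R⁻¹y|²` and `det Σ^(-1/2) = 1/det R`. The latter is
the Jacobian of `y ↦ R y`, which makes `map_mulVec_tStd_one` a change of variables. -/
lemma tStdDensity_mul_self {d : ℕ} (ν : ℝ) {R : Matrix (Fin d) (Fin d) ℝ} (hR : Rᵀ = R)
    (hdet : 0 < R.det) (y : Fin d → ℝ) :
    tStdDensity ν (R * R) y = R.det⁻¹ * tStdDensity ν 1 (R⁻¹ *ᵥ y) := by
  have e1 : y ⬝ᵥ (R * R)⁻¹ *ᵥ y = (R⁻¹ *ᵥ y) ⬝ᵥ (R⁻¹ *ᵥ y) := by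
    rw [Matrix.mul_inv_rev, ← mulVec_mulVec, dotProduct_mulVec, ← mulVec_transpose,
      transpose_nonsing_inv, hR]
  have e2 : (R * R).det ^ (-(1 : ℝ) / 2) = R.det⁻¹ := by
    rw [det_mul, show -(1 : ℝ) / 2 = -(1 / 2) by ring, Real.rpow_neg (by positivity),
      ← Real.sqrt_eq_rpow, Real.sqrt_mul_self hdet.le]
  unfold tStdDensity
  rw [e1, e2]
  simp
  ring

lemma map_mulVec_tStd_one {d : ℕ} {ν : ℝ} {R : Matrix (Fin d) (Fin d) ℝ}
    (hR : Rᵀ = R) (hdet : 0 < R.det) :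
    (tStd ν 1).map (fun y => R *ᵥ y) = tStd ν (R * R) := by
  have hu : IsUnit R.det := hdet.ne'.isUnit
  have h := map_withDensity_equiv (volume : Measure (Fin d → ℝ))
    (mulVecEquiv R R⁻¹ (mul_nonsing_inv R hu) (nonsing_inv_mul R hu))
    (fun y => ENNReal.ofReal (tStdDensity ν 1 y))
  have hv : (volume : Measure (Fin d → ℝ)).map
      (mulVecEquiv R R⁻¹ (mul_nonsing_inv R hu) (nonsing_inv_mul R hu)) =
      ENNReal.ofReal R.det⁻¹ • volume := by
    have := Real.map_matrix_volume_pi_eq_smul_volume_pi hdet.ne'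
    rwa [abs_of_pos (inv_pos.2 hdet)] at this
  rw [hv, withDensity_smul_measure, ← withDensity_smul' _ _ ENNReal.ofReal_ne_top] at h
  refine h.trans ?_
  unfold tStd
  congr 1
  ext y
  rw [tStdDensity_mul_self ν hR hdet, ENNReal.ofReal_mul (inv_pos.2 hdet).le]
  rfl

lemma volume_map_sigmaUncurry {G : Type*} [Fintype G] (m : G → ℕ) :
    (volume : Measure (∀ g, Fin (m g) → ℝ)).map
      (MeasurableEquiv.piCurry fun (g : G) (_ : Fin (m g)) => ℝ).symm = volume := by
  symm
  refine Measure.pi_eq fun s hs => ?_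
  rw [MeasurableEquiv.map_apply]
  have e : (MeasurableEquiv.piCurry fun (g : G) (_ : Fin (m g)) => ℝ).symm ⁻¹' Set.univ.pi s =
      Set.univ.pi fun g => Set.univ.pi fun j => s ⟨g, j⟩ := by
    ext V
    simp only [Set.mem_preimage, Set.mem_pi, Set.mem_univ, true_implies, Sigma.forall]
    rfl
  rw [e, volume_pi_pi]
  simp_rw [volume_pi_pi]
  rw [Fintype.prod_sigma]

/-- Rows and columns have different index types, so a determinant exists only after relabelling
along `e`; relabelling preserves volume, and the square matrix has determinant `±1`. -/
lemma volume_map_mulVec_of_orthonormal {M N : Type*} [Fintype M] [Fintype N] [DecidableEq M]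
    [DecidableEq N] (Q : Matrix N M ℝ) (h : Q * Qᵀ = 1) (h' : Qᵀ * Q = 1) (e : M ≃ N) :
    (volume : Measure (M → ℝ)).map (mulVecEquiv Q Qᵀ h h') = volume := by
  have hQe : Q.submatrix id e.symm * (Q.submatrix id e.symm)ᵀ = 1 := by
    rw [transpose_submatrix, submatrix_mul_equiv, h, submatrix_id_id]
  have hdet : (Q.submatrix id e.symm).det ^ 2 = 1 := by
    have := congrArg det hQe
    rwa [det_mul, det_transpose, det_one, ← sq] at this
  have habs : |(Q.submatrix id e.symm).det⁻¹| = 1 := by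
    have : |(Q.submatrix id e.symm).det| = 1 :=
      (pow_eq_one_iff_of_nonneg (abs_nonneg _) two_ne_zero).1 (by rw [sq_abs, hdet])
    rw [abs_inv, this, inv_one]
  have h0 : (Q.submatrix id e.symm).det ≠ 0 := fun h0 => by simp [h0] at hdet
  have h1 := Real.map_matrix_volume_pi_eq_smul_volume_pi h0
  rw [habs, ENNReal.ofReal_one, one_smul] at h1
  have h2 := (volume_measurePreserving_piCongrLeft (fun _ : N => ℝ) e).map_eq
  have h3 : ⇑(mulVecEquiv Q Qᵀ h h') = (toLin' (Q.submatrix id e.symm)) ∘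
      (MeasurableEquiv.piCongrLeft (fun _ : N => ℝ) e) := by
    ext v i
    simp only [Function.comp_apply, toLin'_apply, mulVec, dotProduct, submatrix_apply, id]
    change ∑ j, Q i j * v j = _
    rw [← e.sum_comp]
    refine Finset.sum_congr rfl fun j _ => ?_
    rw [Equiv.symm_apply_apply]
    congr 1
    exact (Equiv.piCongrLeft_apply_apply (fun _ : N => ℝ) e v j).symm
  rw [h3, ← Measure.map_map _ (MeasurableEquiv.measurable _), h2, h1]
  exact (LinearMap.continuous_of_finiteDimensional _).measurable

lemma blockDiagonal'_mulVec {G : Type*} [Fintype G] [DecidableEq G] {m : G → ℕ}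
    (R : ∀ g, Matrix (Fin (m g)) (Fin (m g)) ℝ) (v : (Σ g, Fin (m g)) → ℝ) (g : G)
    (j : Fin (m g)) :
    (blockDiagonal' R *ᵥ v) ⟨g, j⟩ = (R g *ᵥ fun i => v ⟨g, i⟩) j := by
  simp only [mulVec, dotProduct, Fintype.sum_sigma]
  rw [Finset.sum_eq_single g]
  · simp [blockDiagonal'_apply_eq]
  · intro g' _ hg'
    exact Finset.sum_eq_zero fun i _ => by rw [blockDiagonal'_apply_ne _ _ _ hg'.symm, zero_mul]
  · simp

/-- The density of a convolution-t distribution whose mixing matrix is a product of an orthogonal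
and a block-diagonal matrix. -/
lemma ctStd_mul_blockDiagonal' {G N : Type*} [Fintype G] [DecidableEq G] [Fintype N]
    [DecidableEq N] {m : G → ℕ} {ν : G → ℝ} (hν : ∀ g, 2 < ν g)
    {Q : Matrix N (Σ g, Fin (m g)) ℝ} (h : Q * Qᵀ = 1) (h' : Qᵀ * Q = 1)
    (e : (Σ g, Fin (m g)) ≃ N)
    {R : ∀ g, Matrix (Fin (m g)) (Fin (m g)) ℝ} (hR : ∀ g, (R g)ᵀ = R g)
    (hdet : ∀ g, 0 < (R g).det) (hpos : ∀ g, (R g * R g).PosDef) :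
    ctStd m ν (Q * blockDiagonal' R) = volume.withDensity fun z =>
      ENNReal.ofReal (∏ g, tStdDensity (ν g) (R g * R g) fun j => (Qᵀ *ᵥ z) ⟨g, j⟩) := by
  have hp1 : ∀ g, IsProbabilityMeasure (tStd (ν g) (1 : Matrix (Fin (m g)) (Fin (m g)) ℝ)) :=
    fun g => isProbabilityMeasure_tStd_one (hν g)
  have hmeas : ∀ g, Measurable fun y : Fin (m g) → ℝ => R g *ᵥ y := fun g =>
    (Continuous.matrix_mulVec continuous_const continuous_id).measurable
  have hp : ∀ g, IsProbabilityMeasure (volume.withDensity fun y =>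
      ENNReal.ofReal (tStdDensity (ν g) (R g * R g) y)) := fun g => by
    have := Measure.isProbabilityMeasure_map (μ := tStd (ν g) 1) (hmeas g).aemeasurable
    rwa [map_mulVec_tStd_one (hR g) (hdet g)] at this
  -- Stacking followed by the rotation `Q`, which preserves volume. The blocks `R g` act before
  -- stacking, one group at a time, so independence survives until `E` is applied.
  let E : (∀ g, Fin (m g) → ℝ) ≃ᵐ (N → ℝ) :=
    (MeasurableEquiv.piCurry fun (g : G) (_ : Fin (m g)) => ℝ).symm.trans (mulVecEquiv Q Qᵀ h h')
  have hE : (volume : Measure (∀ g, Fin (m g) → ℝ)).map E = volume := by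
    rw [MeasurableEquiv.coe_trans, ← Measure.map_map (MeasurableEquiv.measurable _)
      (MeasurableEquiv.measurable _), volume_map_sigmaUncurry,
      volume_map_mulVec_of_orthonormal Q h h' e]
  have hfun : (fun V : ∀ g, Fin (m g) → ℝ => (Q * blockDiagonal' R) *ᵥ
      fun p : Σ g, Fin (m g) => V p.1 p.2) = E ∘ fun V g => R g *ᵥ V g := by
    ext V i
    change _ = (Q *ᵥ fun p : Σ g, Fin (m g) => (R p.1 *ᵥ V p.1) p.2) i
    rw [← mulVec_mulVec]
    congr 2
    ext ⟨g, j⟩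
    rw [blockDiagonal'_mulVec]
  have hmap : (Measure.pi fun g => tStd (ν g) (1 : Matrix (Fin (m g)) (Fin (m g)) ℝ)).map
      (fun V g => R g *ᵥ V g) =
      Measure.pi fun g => volume.withDensity fun y =>
        ENNReal.ofReal (tStdDensity (ν g) (R g * R g) y) := by
    have hs : ∀ g, SigmaFinite ((tStd (ν g) 1).map fun y : Fin (m g) → ℝ => R g *ᵥ y) :=
      fun g => by
        have := Measure.isProbabilityMeasure_map (μ := tStd (ν g) 1) (hmeas g).aemeasurable
        infer_instance
    rw [Measure.pi_map_pi fun g => (hmeas g).aemeasurable]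
    congr 1
    ext1 g
    exact map_mulVec_tStd_one (hR g) (hdet g)
  have hRm : Measurable fun (V : ∀ g, Fin (m g) → ℝ) g => R g *ᵥ V g :=
    measurable_pi_lambda _ fun g => (hmeas g).comp (measurable_pi_apply g)
  rw [ctStd, hfun, ← Measure.map_map E.measurable hRm, hmap,
    pi_withDensity_volume (fun g => (continuous_tStdDensity (hν g) (hpos g)).measurable)
      (fun g => tStdDensity_nonneg (hν g) (hpos g)), map_withDensity_equiv, hE]
  rfl

/-! ### The matrix square root -/

section Sqrt

variable {ι : Type*} [Fintype ι] [DecidableEq ι]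

lemma msqrt_posSemidef (M : Matrix ι ι ℝ) : (msqrt M).PosSemidef :=
  nonneg_iff_posSemidef.1 (CFC.sqrt_nonneg M)

lemma msqrt_transpose (M : Matrix ι ι ℝ) : (msqrt M)ᵀ = msqrt M := by
  simpa using (msqrt_posSemidef M).isHermitian.eq

lemma msqrt_mul_self {M : Matrix ι ι ℝ} (hM : M.PosSemidef) : msqrt M * msqrt M = M :=
  CFC.sqrt_mul_sqrt_self M hM.nonneg

lemma msqrt_det_pos {M : Matrix ι ι ℝ} (hM : M.PosDef) : 0 < (msqrt M).det := by
  refine lt_of_le_of_ne (msqrt_posSemidef M).det_nonneg fun h => ?_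
  have h1 := hM.det_pos
  rw [← msqrt_mul_self hM.posSemidef, det_mul, ← h, mul_zero] at h1
  exact lt_irrefl _ h1

lemma msqrt_unique {M R : Matrix ι ι ℝ} (h : R * R = M) (hR : R.PosSemidef) : msqrt M = R :=
  CFC.sqrt_unique h hR.nonneg

lemma inv_msqrt_mul_self {M : Matrix ι ι ℝ} (hM : M.PosDef) :
    (msqrt M)⁻¹ * (msqrt M)⁻¹ = M⁻¹ := by
  rw [← Matrix.mul_inv_rev, msqrt_mul_self hM.posSemidef]

lemma inv_msqrt_transpose (M : Matrix ι ι ℝ) : ((msqrt M)⁻¹)ᵀ = (msqrt M)⁻¹ := by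
  rw [transpose_nonsing_inv, msqrt_transpose]

lemma msqrt_smul_one {c : ℝ} (hc : 0 ≤ c) :
    msqrt (c • (1 : Matrix ι ι ℝ)) = √c • (1 : Matrix ι ι ℝ) := by
  refine msqrt_unique ?_ (PosSemidef.one.smul (Real.sqrt_nonneg c))
  rw [smul_mul_smul_comm, one_mul, Real.mul_self_sqrt hc]

end Sqrt

/-- Iterating the square root writes the matrix as `Bᴴ B`, with `B` the block diagonal of fourth
roots. -/
lemma posSemidef_blockDiagonal'_msqrt {G : Type*} [Fintype G] [DecidableEq G] {m : G → ℕ}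
    (S : ∀ g, Matrix (Fin (m g)) (Fin (m g)) ℝ) :
    (blockDiagonal' fun g => msqrt (S g)).PosSemidef := by
  have h : (blockDiagonal' fun g => msqrt (S g)) =
      (blockDiagonal' fun g => msqrt (msqrt (S g)))ᴴ *
        blockDiagonal' fun g => msqrt (msqrt (S g)) := by
    rw [blockDiagonal'_conjTranspose, ← blockDiagonal'_mul]
    congr 1; ext1 g
    rw [(msqrt_posSemidef _).isHermitian.eq, msqrt_mul_self (msqrt_posSemidef _)]
  rw [h]
  exact posSemidef_conjTranspose_mul_self _

/-- The square root of a matrix that an orthogonal matrix block-diagonalizes. -/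
lemma msqrt_of_mul_eq {G N : Type*} [Fintype G] [DecidableEq G] [Fintype N] [DecidableEq N]
    {m : G → ℕ} {Q : Matrix N (Σ g, Fin (m g)) ℝ} (h : Q * Qᵀ = 1) (h' : Qᵀ * Q = 1)
    {C : Matrix N N ℝ} {S : ∀ g, Matrix (Fin (m g)) (Fin (m g)) ℝ}
    (hS : ∀ g, (S g).PosSemidef) (hC : C * Q = Q * blockDiagonal' S) :
    msqrt C = Q * (blockDiagonal' fun g => msqrt (S g)) * Qᵀ := by
  refine msqrt_unique ?_ ?_
  · calc Q * (blockDiagonal' fun g => msqrt (S g)) * Qᵀ *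
          (Q * (blockDiagonal' fun g => msqrt (S g)) * Qᵀ)
        = Q * ((blockDiagonal' fun g => msqrt (S g)) * (Qᵀ * Q) *
          (blockDiagonal' fun g => msqrt (S g))) * Qᵀ := by simp only [Matrix.mul_assoc]
      _ = Q * blockDiagonal' S * Qᵀ := by
        rw [h', Matrix.mul_one, ← blockDiagonal'_mul]
        simp only [msqrt_mul_self (hS _)]
      _ = C := by rw [← hC, Matrix.mul_assoc, h, Matrix.mul_one]
  · have := (posSemidef_blockDiagonal'_msqrt S).mul_mul_conjTranspose_same Q
    simpa using this

/-- Standardizing by `C^{-1/2}` respects the groups: each `X_g` depends on `Y_g` alone, through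
`S_g^{-1/2}`. -/
lemma transpose_mul_inv_msqrt {G N : Type*} [Fintype G] [DecidableEq G] [Fintype N]
    [DecidableEq N] {m : G → ℕ} {Q : Matrix N (Σ g, Fin (m g)) ℝ} (h : Q * Qᵀ = 1)
    (h' : Qᵀ * Q = 1) {C : Matrix N N ℝ} {S : ∀ g, Matrix (Fin (m g)) (Fin (m g)) ℝ}
    (hS : ∀ g, (S g).PosDef) (hC : C * Q = Q * blockDiagonal' S) :
    Qᵀ * (msqrt C)⁻¹ = (blockDiagonal' fun g => (msqrt (S g))⁻¹) * Qᵀ := by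
  have hi : (msqrt C)⁻¹ = Q * (blockDiagonal' fun g => (msqrt (S g))⁻¹) * Qᵀ := by
    refine inv_eq_right_inv ?_
    rw [msqrt_of_mul_eq h h' (fun g => (hS g).posSemidef) hC]
    calc Q * (blockDiagonal' fun g => msqrt (S g)) * Qᵀ *
          (Q * (blockDiagonal' fun g => (msqrt (S g))⁻¹) * Qᵀ)
        = Q * ((blockDiagonal' fun g => msqrt (S g)) * (Qᵀ * Q) *
          (blockDiagonal' fun g => (msqrt (S g))⁻¹)) * Qᵀ := by simp only [Matrix.mul_assoc]
      _ = 1 := by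
        have hg : (fun g => msqrt (S g) * (msqrt (S g))⁻¹) = 1 := by
          ext1 g
          exact mul_nonsing_inv _ (msqrt_det_pos (hS g)).ne'.isUnit
        rw [h', Matrix.mul_one, ← blockDiagonal'_mul, hg, blockDiagonal'_one, Matrix.mul_one, h]
  rw [hi, ← Matrix.mul_assoc, ← Matrix.mul_assoc, h', Matrix.one_mul]

/-! ### The canonical form of a block correlation matrix -/

section Canonical

variable {K : ℕ} {n : Fin K → ℕ} {F : ∀ k, Matrix (Fin (n k)) (Fin (n k - 1)) ℝ}

/-- The diagonal blocks `A, λ_1 I, …, λ_K I` of `Q' C Q`. -/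
def canonBlocks (n : Fin K → ℕ) (A : Matrix (Fin K) (Fin K) ℝ) :
    ∀ g, Matrix (Fin (canonDims n g)) (Fin (canonDims n g)) ℝ
  | none => A
  | some k => lam n A k • 1

lemma canonQ_none (p : Σ k, Fin (n k)) (l : Fin K) :
    canonQ n F p ⟨none, l⟩ = if p.1 = l then 1 / √(n p.1 : ℝ) else 0 := rfl

lemma canonQ_some_eq (k : Fin K) (i : Fin (n k)) (j : Fin (n k - 1)) :
    canonQ n F ⟨k, i⟩ ⟨some k, j⟩ = F k i j :=
  blockDiagonal'_apply_eq F k i j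

lemma canonQ_some_ne {k l : Fin K} (h : k ≠ l) (i : Fin (n k)) (j : Fin (n l - 1)) :
    canonQ n F ⟨k, i⟩ ⟨some l, j⟩ = 0 :=
  blockDiagonal'_apply_ne F i j h

lemma sum_perpBasis (hn : ∀ k, 2 ≤ n k) (hF : IsPerpBasis n F) (k : Fin K) (j : Fin (n k - 1)) :
    ∑ i, F k i j = 0 := by
  have h := congrFun (hF k).2 j
  simp only [vecMul, dotProduct, Pi.zero_apply, ← Finset.mul_sum] at h
  have h0 : (0 : ℝ) < n k := by have := hn k; positivity
  have h1 : 1 / √(n k : ℝ) ≠ 0 := by positivity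
  exact (mul_eq_zero.1 h).resolve_left h1

/-- The count `K + ∑ (n_k - 1) = ∑ n_k` relies on `n_k ≥ 1`, the subtraction being truncated. It
makes `canonQ` square up to relabelling. -/
lemma card_canonDims (hn : ∀ k, 2 ≤ n k) :
    Fintype.card (Σ k, Fin (n k)) = Fintype.card (Σ g, Fin (canonDims n g)) := by
  have h : ∀ k, n k = 1 + (n k - 1) := fun k => by have := hn k; omega
  simp only [Fintype.card_sigma, Fintype.card_fin, Fintype.sum_option]
  change _ = K + ∑ k, (n k - 1)
  conv_lhs => rw [Finset.sum_congr rfl fun k _ => h k]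
  simp [Finset.sum_add_distrib]

lemma canonQ_transpose_mul_self (hn : ∀ k, 2 ≤ n k) (hF : IsPerpBasis n F) :
    (canonQ n F)ᵀ * canonQ n F = 1 := by
  have hns : ∀ k, (0 : ℝ) < n k := fun k => by have := hn k; positivity
  ext ⟨g, j⟩ ⟨g', j'⟩
  simp only [mul_apply, transpose_apply, Fintype.sum_sigma]
  match g, g', j, j' with
  | none, none, l, l' =>
    change Fin K at l l'
    simp only [canonQ_none]
    rw [Finset.sum_eq_single l (fun k _ hk => by simp [hk]) (by simp)]
    by_cases hl : l = l'
    · subst hl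
      have := hns l
      simp [← mul_inv, this.ne']
    · have : (⟨none, l⟩ : Σ g, Fin (canonDims n g)) ≠ ⟨none, l'⟩ :=
        fun h => hl (eq_of_heq (Sigma.mk.inj h).2)
      simp [hl, one_apply_ne this]
  | none, some k', l, j' =>
    change Fin K at l
    change Fin (n k' - 1) at j'
    rw [Finset.sum_eq_single k' (fun k _ hk => by simp [canonQ_some_ne hk]) (by simp),
      one_apply_ne fun h => Option.some_ne_none _ (congrArg Sigma.fst h).symm]
    simp only [canonQ_none, canonQ_some_eq]
    rw [← Finset.mul_sum, sum_perpBasis hn hF, mul_zero]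
  | some k, none, j, l' =>
    change Fin K at l'
    change Fin (n k - 1) at j
    rw [Finset.sum_eq_single k (fun k' _ hk => by simp [canonQ_some_ne hk]) (by simp),
      one_apply_ne fun h => Option.some_ne_none _ (congrArg Sigma.fst h)]
    simp only [canonQ_none, canonQ_some_eq]
    rw [← Finset.sum_mul, sum_perpBasis hn hF, zero_mul]
  | some k, some k', j, j' =>
    change Fin (n k - 1) at j
    change Fin (n k' - 1) at j'
    rw [Finset.sum_eq_single k (fun k' _ hk => by simp [canonQ_some_ne hk]) (by simp)]
    by_cases hk : k = k'
    · subst hk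
      have h := congrFun (congrFun (hF k).1 j) j'
      simp only [mul_apply, transpose_apply] at h
      simp only [canonQ_some_eq, h]
      by_cases hj : j = j'
      · subst hj; rw [one_apply_eq]; exact (one_apply_eq (⟨some k, j⟩ : Σ g, Fin (canonDims n g))).symm
      · have : (⟨some k, j⟩ : Σ g, Fin (canonDims n g)) ≠ ⟨some k, j'⟩ :=
          fun h => hj (eq_of_heq (Sigma.mk.inj h).2)
        rw [one_apply_ne hj, one_apply_ne this]
    · have : (⟨some k, j⟩ : Σ g, Fin (canonDims n g)) ≠ ⟨some k', j'⟩ :=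
        fun h => hk (Option.some_injective _ (congrArg Sigma.fst h))
      simp [canonQ_some_ne hk, one_apply_ne this]

/-- A left inverse between index types of equal cardinality is a right inverse. -/
lemma canonQ_mul_transpose (hn : ∀ k, 2 ≤ n k) (hF : IsPerpBasis n F) :
    canonQ n F * (canonQ n F)ᵀ = 1 :=
  (mul_eq_one_comm_of_card_eq _ _ ℝ (card_canonDims hn).symm).1
    (canonQ_transpose_mul_self hn hF)

lemma mul_blockDiagonal'_apply {G N : Type*} [Fintype G] [DecidableEq G] {m : G → ℕ}
    (Q : Matrix N (Σ g, Fin (m g)) ℝ) (S : ∀ g, Matrix (Fin (m g)) (Fin (m g)) ℝ) (p : N) (g : G)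
    (j : Fin (m g)) :
    (Q * blockDiagonal' S) p ⟨g, j⟩ = ∑ i, Q p ⟨g, i⟩ * S g i j := by
  rw [mul_apply, Fintype.sum_sigma, Finset.sum_eq_single g]
  · simp [blockDiagonal'_apply_eq]
  · intro g' _ hg'
    exact Finset.sum_eq_zero fun i _ => by rw [blockDiagonal'_apply_ne _ _ _ hg', mul_zero]
  · simp

/-- `C` is constant on blocks apart from an extra `1 - ρ k k` on the diagonal, so it acts on a
column through block sums and a multiple of the entry itself. -/
lemma blockCorr_mul_apply {M : Type*} (ρ : Matrix (Fin K) (Fin K) ℝ)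
    (B : Matrix (Σ k, Fin (n k)) M ℝ) (p : Σ k, Fin (n k)) (c : M) :
    (blockCorr n ρ * B) p c =
      ∑ k, ρ p.1 k * ∑ i, B ⟨k, i⟩ c + (1 - ρ p.1 p.1) * B p c := by
  have h : ∀ q, blockCorr n ρ p q * B q c =
      ρ p.1 q.1 * B q c + if q = p then (1 - ρ p.1 p.1) * B p c else 0 := fun q => by
    by_cases hq : q = p
    · subst hq; simp [blockCorr]; ring
    · simp [blockCorr, hq, Ne.symm hq]
  rw [mul_apply, Finset.sum_congr rfl fun q _ => h q, Finset.sum_add_distrib,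
    Finset.sum_ite_eq' Finset.univ p, if_pos (Finset.mem_univ p), Fintype.sum_sigma]
  simp [Finset.mul_sum]

lemma lam_canonA (hn : ∀ k, 2 ≤ n k) (ρ : Matrix (Fin K) (Fin K) ℝ) (k : Fin K) :
    lam n (canonA n ρ) k = 1 - ρ k k := by
  have h : (2 : ℝ) ≤ n k := by exact_mod_cast hn k
  have h1 : (n k : ℝ) - 1 ≠ 0 := by linarith
  simp only [lam, canonA, of_apply, if_true]
  field_simp
  ring

/-- On the column `v_{n_l}` the block sum is `√n_l`; dividing by the entry `1/√n_k` of `v_{n_k}`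
yields the factor `√(n_k n_l)` in `A`. On the other columns only the diagonal excess acts. -/
lemma blockCorr_mul_canonQ (hn : ∀ k, 2 ≤ n k) (hF : IsPerpBasis n F)
    (ρ : Matrix (Fin K) (Fin K) ℝ) :
    blockCorr n ρ * canonQ n F = canonQ n F * blockDiagonal' (canonBlocks n (canonA n ρ)) := by
  have hns : ∀ k, (0 : ℝ) < n k := fun k => by have := hn k; positivity
  ext ⟨k, i⟩ ⟨g, j⟩
  rw [blockCorr_mul_apply, mul_blockDiagonal'_apply]
  match g, j with
  | none, l =>
    change Fin K at l
    change _ = ∑ i' : Fin K, canonQ n F ⟨k, i⟩ ⟨none, i'⟩ * canonA n ρ i' l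
    simp only [canonQ_none]
    rw [Finset.sum_eq_single l (fun k _ hk => by simp [hk]) (by simp),
      Finset.sum_eq_single k (fun l _ hl => by simp [hl.symm]) (by simp)]
    have hk := hns k
    have hl := hns l
    have hsk := Real.mul_self_sqrt hk.le
    have hsl := Real.mul_self_sqrt hl.le
    have hk' : √(n k : ℝ) ≠ 0 := by positivity
    have hl' : √(n l : ℝ) ≠ 0 := by positivity
    by_cases hkl : k = l
    · subst hkl
      simp only [if_true, canonA, of_apply, Finset.sum_const, Finset.card_univ, Fintype.card_fin,
        nsmul_eq_mul]
      field_simp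
      ring
    · simp only [if_true, if_neg hkl, canonA, of_apply, Finset.sum_const, Finset.card_univ,
        Fintype.card_fin, nsmul_eq_mul]
      rw [Real.sqrt_mul hk.le]
      field_simp
      rw [sq, hsl]; ring
  | some l, j =>
    change Fin (n l - 1) at j
    change _ = ∑ i' : Fin (n l - 1), canonQ n F ⟨k, i⟩ ⟨some l, i'⟩ *
      (lam n (canonA n ρ) l • (1 : Matrix (Fin (n l - 1)) (Fin (n l - 1)) ℝ)) i' j
    -- All block sums of a `v^⊥` column vanish, leaving the eigenvalue `1 - ρ l l = λ_l`.
    have hs : ∀ k', ∑ i', canonQ n F ⟨k', i'⟩ ⟨some l, j⟩ = 0 := fun k' => by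
      by_cases hk : k' = l
      · subst hk
        simp only [canonQ_some_eq, sum_perpBasis hn hF]
      · simp [canonQ_some_ne hk]
    simp only [hs, mul_zero, Finset.sum_const_zero, zero_add, lam_canonA hn]
    rw [Finset.sum_eq_single j (fun i' _ hi => by simp [hi]) (by simp)]
    by_cases hk : k = l
    · subst hk; simp [mul_comm]
    · simp [canonQ_some_ne hk]

lemma blockDiagonal'_canonBlocks_posDef (hn : ∀ k, 2 ≤ n k) (hF : IsPerpBasis n F)
    {ρ : Matrix (Fin K) (Fin K) ℝ} (hpos : (blockCorr n ρ).PosDef) :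
    (blockDiagonal' (canonBlocks n (canonA n ρ))).PosDef := by
  have h' := canonQ_transpose_mul_self hn hF
  have h := hpos.conjTranspose_mul_mul_same (B := canonQ n F)
    (Function.LeftInverse.injective (g := fun v => (canonQ n F)ᵀ *ᵥ v) fun v => by simp [h'])
  rwa [conjTranspose_eq_transpose_of_trivial, Matrix.mul_assoc, blockCorr_mul_canonQ hn hF,
    ← Matrix.mul_assoc, h', Matrix.one_mul] at h

lemma canonBlocks_posDef (hn : ∀ k, 2 ≤ n k) (hF : IsPerpBasis n F)
    {ρ : Matrix (Fin K) (Fin K) ℝ} (hpos : (blockCorr n ρ).PosDef) (g : Option (Fin K)) :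
    (canonBlocks n (canonA n ρ) g).PosDef := by
  have h := (blockDiagonal'_canonBlocks_posDef hn hF hpos).submatrix
    (e := fun j : Fin (canonDims n g) => (⟨g, j⟩ : Σ g, Fin (canonDims n g)))
    (fun i j hij => by simpa using hij)
  convert h using 1
  ext i j
  rw [submatrix_apply, blockDiagonal'_apply_eq]

lemma canonA_posDef (hn : ∀ k, 2 ≤ n k) (hF : IsPerpBasis n F)
    {ρ : Matrix (Fin K) (Fin K) ℝ} (hpos : (blockCorr n ρ).PosDef) : (canonA n ρ).PosDef :=
  canonBlocks_posDef hn hF hpos none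

lemma lam_pos (hn : ∀ k, 2 ≤ n k) (hF : IsPerpBasis n F)
    {ρ : Matrix (Fin K) (Fin K) ℝ} (hpos : (blockCorr n ρ).PosDef) (k : Fin K) :
    0 < lam n (canonA n ρ) k := by
  have h := (canonBlocks_posDef hn hF hpos (some k)).diag_pos
    -- The block `λ_k I` is nonempty because `n_k ≥ 2`; otherwise it would say nothing about `λ_k`.
    (i := (⟨0, by have := hn k; omega⟩ : Fin (n k - 1)))
  change 0 < (lam n (canonA n ρ) k • (1 : Matrix (Fin (n k - 1)) (Fin (n k - 1)) ℝ)) _ _ at h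
  simpa using h

end Canonical

/-! ### The log-likelihood and the canonical variables. -/

lemma tStdDensity_eq_exp {d : ℕ} {ν : ℝ} (hν : 2 < ν) {S : Matrix (Fin d) (Fin d) ℝ}
    (hS : S.PosDef) (y : Fin d → ℝ) :
    tStdDensity ν S y = Real.exp (normConst ν d - 1 / 2 * Real.log S.det
      - (ν + d) / 2 * Real.log (1 + 1 / (ν - 2) * (y ⬝ᵥ S⁻¹ *ᵥ y))) := by
  have h1 : 0 < Real.Gamma ((ν + d) / 2) := Real.Gamma_pos_of_pos (by positivity)
  have h2 : 0 < Real.Gamma (ν / 2) := Real.Gamma_pos_of_pos (by positivity)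
  have h4 : 0 < ν - 2 := by linarith
  have h5 : 0 ≤ 1 / (ν - 2) * (y ⬝ᵥ S⁻¹ *ᵥ y) := by
    have : 0 ≤ y ⬝ᵥ S⁻¹ *ᵥ y := by simpa using hS.inv.posSemidef.dotProduct_mulVec_nonneg y
    positivity
  have h6 : 0 < 1 + 1 / (ν - 2) * (y ⬝ᵥ S⁻¹ *ᵥ y) := by linarith
  rw [tStdDensity, normConst, Real.rpow_def_of_pos (by positivity : 0 < (ν - 2) * Real.pi),
    Real.rpow_def_of_pos hS.det_pos, Real.rpow_def_of_pos h6]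
  rw [show Real.Gamma ((ν + d) / 2) / Real.Gamma (ν / 2) =
    Real.exp (Real.log (Real.Gamma ((ν + d) / 2) / Real.Gamma (ν / 2))) from
    (Real.exp_log (by positivity)).symm]
  simp only [← Real.exp_add, Real.log_exp]
  congr 1
  ring

section Model

variable {K : ℕ} {n : Fin K → ℕ} {F : ∀ k, Matrix (Fin (n k)) (Fin (n k - 1)) ℝ}
  {ν : Option (Fin K) → ℝ} {ρ : Matrix (Fin K) (Fin K) ℝ}

lemma msqrt_blockCorr_mul_canonQ (hn : ∀ k, 2 ≤ n k) (hF : IsPerpBasis n F)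
    (hpos : (blockCorr n ρ).PosDef) :
    msqrt (blockCorr n ρ) * canonQ n F =
      canonQ n F * blockDiagonal' fun g => msqrt (canonBlocks n (canonA n ρ) g) := by
  have h' := canonQ_transpose_mul_self hn hF
  rw [msqrt_of_mul_eq (canonQ_mul_transpose hn hF) h'
    (fun g => (canonBlocks_posDef hn hF hpos g).posSemidef) (blockCorr_mul_canonQ hn hF ρ),
    Matrix.mul_assoc, h', Matrix.mul_one]

lemma canonQ_inv_msqrt_mulVec (hn : ∀ k, 2 ≤ n k) (hF : IsPerpBasis n F)
    (hpos : (blockCorr n ρ).PosDef) (z : (Σ k, Fin (n k)) → ℝ) (g : Option (Fin K))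
    (j : Fin (canonDims n g)) :
    ((canonQ n F)ᵀ *ᵥ ((msqrt (blockCorr n ρ))⁻¹ *ᵥ z)) ⟨g, j⟩ =
      ((msqrt (canonBlocks n (canonA n ρ) g))⁻¹ *ᵥ
        fun i => ((canonQ n F)ᵀ *ᵥ z) ⟨g, i⟩) j := by
  rw [mulVec_mulVec, transpose_mul_inv_msqrt (canonQ_mul_transpose hn hF)
    (canonQ_transpose_mul_self hn hF) (canonBlocks_posDef hn hF hpos)
    (blockCorr_mul_canonQ hn hF ρ), ← mulVec_mulVec, blockDiagonal'_mulVec]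

lemma X0_eq (hn : ∀ k, 2 ≤ n k) (hF : IsPerpBasis n F) (hpos : (blockCorr n ρ).PosDef)
    (z : (Σ k, Fin (n k)) → ℝ) :
    X0 n F (blockCorr n ρ) z = (msqrt (canonA n ρ))⁻¹ *ᵥ Y0 n F z :=
  funext fun j => canonQ_inv_msqrt_mulVec hn hF hpos z none j

lemma Xk_eq (hn : ∀ k, 2 ≤ n k) (hF : IsPerpBasis n F) (hpos : (blockCorr n ρ).PosDef)
    (z : (Σ k, Fin (n k)) → ℝ) (k : Fin K) :
    Xk n F (blockCorr n ρ) z k = (√(lam n (canonA n ρ) k))⁻¹ • Yk n F z k := by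
  have hl := lam_pos hn hF hpos k
  have h : Xk n F (blockCorr n ρ) z k =
      (msqrt (lam n (canonA n ρ) k • (1 : Matrix (Fin (n k - 1)) (Fin (n k - 1)) ℝ)))⁻¹ *ᵥ
        Yk n F z k :=
    funext fun j => canonQ_inv_msqrt_mulVec hn hF hpos z (some k) j
  have hi : (√(lam n (canonA n ρ) k) • (1 : Matrix (Fin (n k - 1)) (Fin (n k - 1)) ℝ))⁻¹ =
      (√(lam n (canonA n ρ) k))⁻¹ • 1 := by
    refine inv_eq_right_inv ?_
    rw [smul_mul_smul_comm, mul_inv_cancel₀ (Real.sqrt_pos.2 hl).ne', one_mul, one_smul]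
  rw [h, msqrt_smul_one hl.le, hi, smul_mulVec, one_mulVec]

lemma dotProduct_X0 (hn : ∀ k, 2 ≤ n k) (hF : IsPerpBasis n F) (hpos : (blockCorr n ρ).PosDef)
    (z : (Σ k, Fin (n k)) → ℝ) :
    X0 n F (blockCorr n ρ) z ⬝ᵥ X0 n F (blockCorr n ρ) z =
      Y0 n F z ⬝ᵥ (canonA n ρ)⁻¹ *ᵥ Y0 n F z := by
  rw [X0_eq hn hF hpos, ← inv_msqrt_mul_self (canonA_posDef hn hF hpos), ← mulVec_mulVec,
    dotProduct_mulVec, ← mulVec_transpose, inv_msqrt_transpose, dotProduct_comm]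

lemma dotProduct_Xk (hn : ∀ k, 2 ≤ n k) (hF : IsPerpBasis n F) (hpos : (blockCorr n ρ).PosDef)
    (z : (Σ k, Fin (n k)) → ℝ) (k : Fin K) :
    Xk n F (blockCorr n ρ) z k ⬝ᵥ Xk n F (blockCorr n ρ) z k =
      (Yk n F z k ⬝ᵥ Yk n F z k) * (lam n (canonA n ρ) k)⁻¹ := by
  have hl := lam_pos hn hF hpos k
  rw [Xk_eq hn hF hpos, smul_dotProduct, dotProduct_smul, smul_eq_mul, smul_eq_mul, ← mul_assoc,
    ← mul_inv, Real.mul_self_sqrt hl.le, mul_comm]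

lemma natCast_sub_one (hn : ∀ k, 2 ≤ n k) (k : Fin K) : ((n k - 1 : ℕ) : ℝ) = n k - 1 := by
  have := hn k
  rw [Nat.cast_sub (by omega), Nat.cast_one]

/-- The log-likelihood is the log-density of the convolution-t distribution. -/
lemma ctStd_eq_withDensity_logLik (hn : ∀ k, 2 ≤ n k) (hF : IsPerpBasis n F)
    (hν : ∀ g, 2 < ν g) (hpos : (blockCorr n ρ).PosDef) :
    ctStd (canonDims n) ν (msqrt (blockCorr n ρ) * canonQ n F) =
      volume.withDensity fun z =>
        ENNReal.ofReal (Real.exp (logLik n F ν (canonA n ρ) z)) := by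
  have hP := canonBlocks_posDef hn hF hpos
  have hsq : ∀ g, msqrt (canonBlocks n (canonA n ρ) g) * msqrt (canonBlocks n (canonA n ρ) g) =
      canonBlocks n (canonA n ρ) g := fun g => msqrt_mul_self (hP g).posSemidef
  rw [msqrt_blockCorr_mul_canonQ hn hF hpos,
    ctStd_mul_blockDiagonal' hν (canonQ_mul_transpose hn hF) (canonQ_transpose_mul_self hn hF)
      (Fintype.equivOfCardEq (card_canonDims hn).symm) (fun g => msqrt_transpose _)
      (fun g => msqrt_det_pos (hP g)) (fun g => by rw [hsq]; exact hP g)]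
  congr 1
  ext z
  congr 1
  simp only [hsq]
  rw [Finset.prod_congr rfl fun g _ => tStdDensity_eq_exp (hν g) (hP g) _, ← Real.exp_sum,
    Fintype.sum_option, logLik]
  congr 2
  refine Finset.sum_congr rfl fun k _ => ?_
  have hl := lam_pos hn hF hpos k
  change normConst (ν (some k)) (n k - 1) - 1 / 2 * Real.log
      (lam n (canonA n ρ) k • (1 : Matrix (Fin (n k - 1)) (Fin (n k - 1)) ℝ)).det
    - (ν (some k) + (n k - 1 : ℕ)) / 2 * Real.log (1 + 1 / (ν (some k) - 2) * (Yk n F z k ⬝ᵥ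
      (lam n (canonA n ρ) k • (1 : Matrix (Fin (n k - 1)) (Fin (n k - 1)) ℝ))⁻¹ *ᵥ
        Yk n F z k)) = _
  have hi : (lam n (canonA n ρ) k • (1 : Matrix (Fin (n k - 1)) (Fin (n k - 1)) ℝ))⁻¹ =
      (lam n (canonA n ρ) k)⁻¹ • 1 := by
    refine inv_eq_right_inv ?_
    rw [smul_mul_smul_comm, mul_inv_cancel₀ hl.ne', one_mul, one_smul]
  rw [hi, smul_mulVec, one_mulVec, dotProduct_smul, det_smul, det_one, mul_one, Fintype.card_fin,
    Real.log_pow, natCast_sub_one hn, smul_eq_mul]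
  ring_nf

end Model

/-! ### Derivatives of determinants and inverses -/

section MatrixCalculus

variable {ι : Type*} [Fintype ι] [DecidableEq ι]

lemma differentiableAt_det {E : Type*} [NormedAddCommGroup E] [NormedSpace ℝ E]
    {f : E → Matrix ι ι ℝ} {a : E} (hf : ∀ i j, DifferentiableAt ℝ (fun x => f x i j) a) :
    DifferentiableAt ℝ (fun x => (f x).det) a := by
  simp only [det_apply]
  refine DifferentiableAt.fun_sum fun σ _ => DifferentiableAt.const_smul ?_ _
  exact (HasFDerivAt.finsetProd fun i _ => (hf (σ i) i).hasFDerivAt).differentiableAt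

/-- By Cramer's rule the entries are quotients of determinants, and determinants are polynomials in
the entries. -/
lemma differentiableAt_inv_apply {E : Type*} [NormedAddCommGroup E] [NormedSpace ℝ E]
    {f : E → Matrix ι ι ℝ} {a : E} (hf : ∀ i j, DifferentiableAt ℝ (fun x => f x i j) a)
    (h0 : (f a).det ≠ 0) (i j : ι) : DifferentiableAt ℝ (fun x => (f x)⁻¹ i j) a := by
  simp only [inv_def, Matrix.smul_apply, Ring.inverse_eq_inv', smul_eq_mul, adjugate_apply]
  refine ((differentiableAt_det hf).inv h0).mul (differentiableAt_det fun k l => ?_)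
  by_cases hk : k = j
  · subst hk; simp
  · simpa [updateRow_ne hk] using hf k l

lemma det_add_smul_single {A : Matrix ι ι ℝ} (hA : IsUnit A.det) (i j : ι) (t : ℝ) :
    (A + t • single i j 1).det = A.det * (1 + t * A⁻¹ j i) := by
  have h := det_add_replicateCol_mul_replicateRow (ι := Unit) hA (t • Pi.single i 1)
    (Pi.single j 1)
  refine (congrArg det ?_).trans (h.trans ?_)
  · ext k l
    simp only [Matrix.add_apply, Matrix.smul_apply, single_apply, Matrix.mul_apply,
      replicateCol_apply, replicateRow_apply, Pi.smul_apply, Pi.single_apply, smul_eq_mul,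
      Finset.univ_unique, Finset.sum_singleton]
    grind
  · congr 1
    simp [Matrix.mul_apply, Pi.single_apply, mul_comm]

/-- Sherman–Morrison for the rank-one matrix unit: `E A⁻¹ E = (A⁻¹ j i) E` terminates the Neumann
series in closed form. -/
lemma inv_add_smul_single {A : Matrix ι ι ℝ} (hA : IsUnit A.det) (i j : ι) {t : ℝ}
    (ht : 1 + t * A⁻¹ j i ≠ 0) :
    (A + t • single i j 1)⁻¹ =
      A⁻¹ - (t / (1 + t * A⁻¹ j i)) • (A⁻¹ * single i j 1 * A⁻¹) := by
  refine inv_eq_right_inv ?_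
  have h1 : A * A⁻¹ = 1 := mul_nonsing_inv A hA
  have h2 : single i j (1 : ℝ) * A⁻¹ * single i j 1 = A⁻¹ j i • single i j 1 := by
    rw [single_mul_mul_single]; simp
  have h3 : A * (A⁻¹ * single i j 1 * A⁻¹) = single i j 1 * A⁻¹ := by
    rw [← Matrix.mul_assoc, ← Matrix.mul_assoc, h1, Matrix.one_mul]
  have h4 : single i j 1 * (A⁻¹ * single i j 1 * A⁻¹) = A⁻¹ j i • (single i j 1 * A⁻¹) := by
    rw [← Matrix.mul_assoc, ← Matrix.mul_assoc, h2, Matrix.smul_mul]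
  rw [Matrix.add_mul, Matrix.mul_sub, Matrix.mul_sub, h1, Matrix.mul_smul, h3, Matrix.smul_mul, Matrix.smul_mul,
    Matrix.mul_smul, h4]
  have : t - t / (1 + t * A⁻¹ j i) - t * (t / (1 + t * A⁻¹ j i) * A⁻¹ j i) = 0 := by
    field_simp; ring
  calc _ = (1 : Matrix ι ι ℝ) + (t - t / (1 + t * A⁻¹ j i)
        - t * (t / (1 + t * A⁻¹ j i) * A⁻¹ j i)) • (single i j 1 * A⁻¹) := by module
    _ = 1 := by rw [this, zero_smul, add_zero]

lemma hasDerivAt_det_add_smul_single {A : Matrix ι ι ℝ} (hA : IsUnit A.det) (i j : ι) :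
    HasDerivAt (fun t : ℝ => (A + t • single i j 1).det) (A.det * A⁻¹ j i) 0 := by
  simp only [det_add_smul_single hA]
  have := (((hasDerivAt_id (0 : ℝ)).mul_const (A⁻¹ j i)).const_add 1).const_mul A.det
  simpa using this

/-- The first-order term of Sherman–Morrison. Symmetry is used only at the base point, to write both
factors as `A⁻¹ y`; the perturbed matrix is not symmetric in general, in keeping with `K²` free
entries. -/
lemma hasDerivAt_inv_quadForm_add_smul_single {A : Matrix ι ι ℝ} (hA : IsUnit A.det)
    (hsymm : Aᵀ = A) (y : ι → ℝ) (i j : ι) :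
    HasDerivAt (fun t : ℝ => y ⬝ᵥ (A + t • single i j 1)⁻¹ *ᵥ y)
      (-((A⁻¹ *ᵥ y) i * (A⁻¹ *ᵥ y) j)) 0 := by
  have hq : y ⬝ᵥ (A⁻¹ * single i j 1 * A⁻¹) *ᵥ y = (A⁻¹ *ᵥ y) i * (A⁻¹ *ᵥ y) j := by
    rw [Matrix.mul_assoc, ← mulVec_mulVec, ← mulVec_mulVec, dotProduct_mulVec, ← mulVec_transpose,
      transpose_nonsing_inv, hsymm]
    simp [-mulVec_mulVec, single_mulVec, dotProduct, Function.update_apply]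
  -- The closed form holds only where `1 + t A⁻¹ j i ≠ 0`, hence near `t = 0`.
  have hev : (fun t : ℝ => y ⬝ᵥ (A + t • single i j 1)⁻¹ *ᵥ y) =ᶠ[nhds 0] fun t =>
      y ⬝ᵥ A⁻¹ *ᵥ y - t / (1 + t * A⁻¹ j i) * ((A⁻¹ *ᵥ y) i * (A⁻¹ *ᵥ y) j) := by
    have hc : ContinuousAt (fun t : ℝ => 1 + t * A⁻¹ j i) 0 := by fun_prop
    filter_upwards [hc.eventually_ne (by simp : (1 : ℝ) + 0 * A⁻¹ j i ≠ 0)] with t ht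
    rw [inv_add_smul_single hA i j ht, sub_mulVec, smul_mulVec, dotProduct_sub, dotProduct_smul,
      hq, smul_eq_mul]
  refine HasDerivAt.congr_of_eventuallyEq ?_ hev
  have h := (((hasDerivAt_id (0 : ℝ)).fun_div
    (((hasDerivAt_id (0 : ℝ)).mul_const (A⁻¹ j i)).const_add 1) (by simp)).mul_const
      ((A⁻¹ *ᵥ y) i * (A⁻¹ *ᵥ y) j)).const_sub (y ⬝ᵥ A⁻¹ *ᵥ y)
  simpa using h

end MatrixCalculus

/-! ### Differentiation of the log-likelihood. -/

section Score

variable {K : ℕ} {n : Fin K → ℕ} {F : ∀ k, Matrix (Fin (n k)) (Fin (n k - 1)) ℝ}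
  {ν : Option (Fin K) → ℝ} {A : Matrix (Fin K) (Fin K) ℝ}

lemma one_add_inv_mul_pos {ν q : ℝ} (hν : 2 < ν) (hq : 0 ≤ q) : 0 < 1 + 1 / (ν - 2) * q := by
  have : 0 < ν - 2 := by linarith
  positivity

lemma inv_quadForm_nonneg (hA : A.PosDef) (y : Fin K → ℝ) : 0 ≤ y ⬝ᵥ A⁻¹ *ᵥ y := by
  simpa using hA.inv.posSemidef.dotProduct_mulVec_nonneg y

/-- Besides being claimed, this gives `fderiv` its meaning (it is zero by default), so the score may
be computed along coordinate lines. -/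
lemma differentiableAt_logLikVec (hν : ∀ g, 2 < ν g) (hA : A.PosDef)
    (hl : ∀ k, 0 < lam n A k) (z : (Σ k, Fin (n k)) → ℝ) :
    DifferentiableAt ℝ (logLikVec n F ν z) (vec A) := by
  have hent : ∀ i j, DifferentiableAt ℝ (fun a : Fin K × Fin K → ℝ => unvec a i j) (vec A) :=
    fun i j => differentiableAt_apply (j, i) (vec A)
  have hdet : (unvec (vec A)).det ≠ 0 := hA.det_pos.ne'
  have hq : DifferentiableAt ℝ (fun a => Y0 n F z ⬝ᵥ (unvec a)⁻¹ *ᵥ Y0 n F z) (vec A) := by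
    simp only [dotProduct, mulVec]
    refine DifferentiableAt.fun_sum fun i _ => DifferentiableAt.const_mul ?_ _
    exact DifferentiableAt.fun_sum fun j _ =>
      (differentiableAt_inv_apply hent hdet i j).mul_const _
  have hlam : ∀ k, DifferentiableAt ℝ (fun a => lam n (unvec a) k) (vec A) := fun k => by
    simp only [lam, div_eq_mul_inv]
    exact ((hent k k).const_sub _).mul_const _
  unfold logLikVec logLik
  refine DifferentiableAt.add (DifferentiableAt.sub (DifferentiableAt.sub
    (differentiableAt_const _) ?_) ?_) (DifferentiableAt.fun_sum fun k _ =>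
      DifferentiableAt.sub (DifferentiableAt.sub (differentiableAt_const _) ?_) ?_)
  · exact ((differentiableAt_det hent).log hdet).const_mul _
  · exact (((hq.const_mul _).const_add _).log
      (one_add_inv_mul_pos (hν none) (inv_quadForm_nonneg hA _)).ne').const_mul _
  · exact ((hlam k).log (hl k).ne').const_mul _
  · refine (((((hlam k).inv (hl k).ne').const_mul _).const_mul _).const_add _ |>.log
      (one_add_inv_mul_pos (hν (some k)) ?_).ne').const_mul _
    exact mul_nonneg (dotProduct_self_nonneg' _) (inv_nonneg.2 (hl k).le)

/-- `vec` stacks columns, so an index is a pair (column, row) and the matrix unit has its indices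
swapped. -/
lemma unvec_add_smul_single (A : Matrix (Fin K) (Fin K) ℝ) (p : Fin K × Fin K) (t : ℝ) :
    unvec (vec A + t • Pi.single p 1) = A + t • single p.2 p.1 1 := by
  ext i j
  simp only [unvec, of_apply, Pi.add_apply, vec, Pi.smul_apply, Pi.single_apply, Matrix.add_apply,
    Matrix.smul_apply, single_apply, Prod.ext_iff]
  grind

lemma hasDerivAt_lam (p : Fin K × Fin K) (k : Fin K) :
    HasDerivAt (fun t : ℝ => lam n (A + t • single p.2 p.1 1) k)
      (-(if p.1 = k ∧ p.2 = k then 1 else 0) / ((n k : ℝ) - 1)) 0 := by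
  have h : (fun t : ℝ => lam n (A + t • single p.2 p.1 1) k) = fun t =>
      ((n k : ℝ) - (A k k + t * if p.1 = k ∧ p.2 = k then 1 else 0)) / ((n k : ℝ) - 1) := by
    ext t
    simp only [lam, Matrix.add_apply, Matrix.smul_apply, single_apply, smul_eq_mul, and_comm]
  rw [h]
  refine (((((hasDerivAt_id (0 : ℝ)).mul_const _).const_add (A k k)).const_sub
    (n k : ℝ)).div_const _).congr_deriv ?_
  simp

/-- The partial derivatives of the log-likelihood in the entries of `A`. -/
lemma score_apply (hn : ∀ k, 2 ≤ n k) (hν : ∀ g, 2 < ν g) (hA : A.PosDef)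
    (hl : ∀ k, 0 < lam n A k) (z : (Σ k, Fin (n k)) → ℝ) (p : Fin K × Fin K) :
    score n F ν A z p =
      1 / 2 * ((ν none + K) / (ν none - 2 + Y0 n F z ⬝ᵥ A⁻¹ *ᵥ Y0 n F z) *
          ((A⁻¹ *ᵥ Y0 n F z) p.2 * (A⁻¹ *ᵥ Y0 n F z) p.1) - A⁻¹ p.1 p.2)
      + 1 / 2 * ∑ k, (if p.1 = k ∧ p.2 = k then 1 else 0) * (1 / lam n A k
        - (ν (some k) + n k - 1) /
            (ν (some k) - 2 + (Yk n F z k ⬝ᵥ Yk n F z k) * (lam n A k)⁻¹) *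
          ((Yk n F z k ⬝ᵥ Yk n F z k) * (lam n A k)⁻¹) / (lam n A k * ((n k : ℝ) - 1))) := by
  have hsymm : Aᵀ = A := by simpa using hA.isHermitian.eq
  have hu : IsUnit A.det := hA.det_pos.ne'.isUnit
  have h1 := ((differentiableAt_logLikVec (F := F) hν hA hl z).hasFDerivAt.hasLineDerivAt
    (Pi.single p 1))
  unfold HasLineDerivAt at h1
  simp only [logLikVec, unvec_add_smul_single, logLik] at h1
  have hdet := ((hasDerivAt_det_add_smul_single hu p.2 p.1).log
    (by simpa using hu.ne_zero)).const_mul (1 / 2)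
  have hq0 := inv_quadForm_nonneg hA (Y0 n F z)
  have hb0 := one_add_inv_mul_pos (hν none) hq0
  have hq := (((((hasDerivAt_inv_quadForm_add_smul_single hu hsymm (Y0 n F z) p.2 p.1).const_mul
    (1 / (ν none - 2))).const_add 1).log (by simpa using hb0.ne')).const_mul ((ν none + K) / 2))
  have hk : ∀ k ∈ Finset.univ, HasDerivAt (fun t : ℝ => normConst (ν (some k)) (n k - 1)
      - 1 / 2 * ((n k : ℝ) - 1) * Real.log (lam n (A + t • single p.2 p.1 1) k)
      - (ν (some k) + n k - 1) / 2 * Real.log (1 + 1 / (ν (some k) - 2) *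
            ((Yk n F z k ⬝ᵥ Yk n F z k) * (lam n (A + t • single p.2 p.1 1) k)⁻¹)))
      (1 / 2 * ((if p.1 = k ∧ p.2 = k then 1 else 0) * (1 / lam n A k
        - (ν (some k) + n k - 1) /
            (ν (some k) - 2 + (Yk n F z k ⬝ᵥ Yk n F z k) * (lam n A k)⁻¹) *
          ((Yk n F z k ⬝ᵥ Yk n F z k) * (lam n A k)⁻¹) / (lam n A k * ((n k : ℝ) - 1))))) 0 := by
    intro k _
    have hlk := hl k
    have hyk : 0 ≤ (Yk n F z k ⬝ᵥ Yk n F z k) := dotProduct_self_nonneg' _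
    have hbk := one_add_inv_mul_pos (hν (some k)) (mul_nonneg hyk (inv_nonneg.2 hlk.le))
    have hd := hasDerivAt_lam (n := n) (A := A) p k
    have e0 : lam n (A + (0 : ℝ) • single p.2 p.1 1) k = lam n A k := by simp
    have hL := (hd.log (by rw [e0]; exact hlk.ne')).const_mul (1 / 2 * ((n k : ℝ) - 1))
    have hI := ((((hd.fun_inv (by rw [e0]; exact hlk.ne')).const_mul
      (Yk n F z k ⬝ᵥ Yk n F z k)).const_mul (1 / (ν (some k) - 2))).const_add 1).log
        (by rw [e0]; exact hbk.ne')
    refine ((hL.const_sub (normConst (ν (some k)) (n k - 1))).fun_sub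
      (hI.const_mul ((ν (some k) + n k - 1) / 2))).congr_deriv ?_
    rw [e0]
    have hn2 : (2 : ℝ) ≤ n k := by exact_mod_cast hn k
    have hn1 : (n k : ℝ) - 1 ≠ 0 := by linarith
    have hν2 : 0 < ν (some k) - 2 := by linarith [hν (some k)]
    have hden : ν (some k) - 2 + (Yk n F z k ⬝ᵥ Yk n F z k) * (lam n A k)⁻¹ ≠ 0 := by positivity
    have hden2 : 1 + 1 / (ν (some k) - 2) * ((Yk n F z k ⬝ᵥ Yk n F z k) * (lam n A k)⁻¹) =
        (ν (some k) - 2 + (Yk n F z k ⬝ᵥ Yk n F z k) * (lam n A k)⁻¹) / (ν (some k) - 2) := by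
      field_simp
    rw [hden2]
    generalize ν (some k) - 2 + (Yk n F z k ⬝ᵥ Yk n F z k) * (lam n A k)⁻¹ = D at hden ⊢
    have hlk' := hlk.ne'
    have hν2' := hν2.ne'
    -- Only the entry `A_kk` moves `λ_k`; for the others both sides vanish.
    split_ifs
    · field_simp
    · simp
  have h2 := ((hdet.const_sub (normConst (ν none) K)).fun_sub hq).fun_add
    (HasDerivAt.fun_sum hk)
  -- The `fderiv` along the coordinate line and the termwise derivative are derivatives of the same
  -- function.
  refine (h1.unique h2).trans ?_
  rw [Finset.mul_sum]
  congr 1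
  have hν2 : 0 < ν none - 2 := by linarith [hν none]
  have hden : ν none - 2 + Y0 n F z ⬝ᵥ A⁻¹ *ᵥ Y0 n F z ≠ 0 := by positivity
  have hden2 : 1 + 1 / (ν none - 2) * (Y0 n F z ⬝ᵥ A⁻¹ *ᵥ Y0 n F z) =
      (ν none - 2 + Y0 n F z ⬝ᵥ A⁻¹ *ᵥ Y0 n F z) / (ν none - 2) := by field_simp
  simp only [zero_smul, add_zero]
  rw [hden2]
  generalize ν none - 2 + Y0 n F z ⬝ᵥ A⁻¹ *ᵥ Y0 n F z = D at hden ⊢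
  have hν2' := hν2.ne'
  have hd0 := hu.ne_zero
  field_simp
  ring

lemma diagElim_transpose_mulVec (s : Fin K → ℝ) (p : Fin K × Fin K) :
    ((diagElim (Fin K))ᵀ *ᵥ s) p = ∑ k, (if p.1 = k ∧ p.2 = k then 1 else 0) * s k := rfl

/-- The score in terms of the standardized canonical variables. -/
lemma score_eq {ρ : Matrix (Fin K) (Fin K) ℝ} (hn : ∀ k, 2 ≤ n k) (hF : IsPerpBasis n F)
    (hν : ∀ g, 2 < ν g) (hpos : (blockCorr n ρ).PosDef) (z : (Σ k, Fin (n k)) → ℝ) :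
    score n F ν (canonA n ρ) z
      = (1 / 2 : ℝ) • (((msqrt (canonA n ρ))⁻¹ ⊗ₖ (msqrt (canonA n ρ))⁻¹) *ᵥ
          (W0 n F ν (blockCorr n ρ) z •
              vec (vecMulVec (X0 n F (blockCorr n ρ) z) (X0 n F (blockCorr n ρ) z))
            - vec (1 : Matrix (Fin K) (Fin K) ℝ)))
        + (1 / 2 : ℝ) • ((diagElim (Fin K))ᵀ *ᵥ Svec n F ν (canonA n ρ) (blockCorr n ρ) z) := by
  have hA := canonA_posDef hn hF hpos
  ext p
  rw [score_apply hn hν hA (lam_pos hn hF hpos) z p]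
  have hR := inv_msqrt_transpose (canonA n ρ)
  have hRX : (msqrt (canonA n ρ))⁻¹ *ᵥ X0 n F (blockCorr n ρ) z =
      (canonA n ρ)⁻¹ *ᵥ Y0 n F z := by
    rw [X0_eq hn hF hpos, mulVec_mulVec, inv_msqrt_mul_self hA]
  -- `(R ⊗ R) vec B = vec (R B R')` with `R = A^{-1/2}`, and `R X_0 = A⁻¹ Y_0`.
  have hvec : (((msqrt (canonA n ρ))⁻¹ ⊗ₖ (msqrt (canonA n ρ))⁻¹) *ᵥ
      (W0 n F ν (blockCorr n ρ) z •
        vec (vecMulVec (X0 n F (blockCorr n ρ) z) (X0 n F (blockCorr n ρ) z))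
          - vec (1 : Matrix (Fin K) (Fin K) ℝ))) p =
      W0 n F ν (blockCorr n ρ) z * (((canonA n ρ)⁻¹ *ᵥ Y0 n F z) p.2 *
        ((canonA n ρ)⁻¹ *ᵥ Y0 n F z) p.1) - (canonA n ρ)⁻¹ p.2 p.1 := by
    rw [mulVec_sub, mulVec_smul, kronecker_mulVec_vec, kronecker_mulVec_vec, Matrix.mul_one, hR,
      inv_msqrt_mul_self hA, mul_vecMulVec, vecMulVec_mul, ← mulVec_transpose, hR, hRX]
    rfl
  have hsymm : ((canonA n ρ)⁻¹)ᵀ = (canonA n ρ)⁻¹ := by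
    rw [transpose_nonsing_inv]
    congr 1
    simpa using hA.isHermitian.eq
  rw [Pi.add_apply, Pi.smul_apply, Pi.smul_apply, hvec, diagElim_transpose_mulVec, smul_eq_mul,
    smul_eq_mul, W0, dotProduct_X0 hn hF hpos,
    show (canonA n ρ)⁻¹ p.2 p.1 = (canonA n ρ)⁻¹ p.1 p.2 from congrFun (congrFun hsymm p.1) p.2]
  simp only [Svec, Wk, dotProduct_Xk hn hF hpos]

end Score

/-! ### Score statistics of the standard t-distribution -/

section ScoreStatistics

variable {d : ℕ} {ν : ℝ}

/-- The statistic `W vec(yy') - vec(I)`. -/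
def vecStat (ν : ℝ) (y : Fin d → ℝ) : Fin d × Fin d → ℝ :=
  tWeight ν y • vec (vecMulVec y y) - vec (1 : Matrix (Fin d) (Fin d) ℝ)

/-- The statistic `1 - W y'y / d`. -/
def radialStat (ν : ℝ) (y : Fin d → ℝ) : ℝ := 1 - tWeight ν y * (y ⬝ᵥ y) / d

lemma vecStat_apply (y : Fin d → ℝ) (p : Fin d × Fin d) :
    vecStat ν y p = tWeight ν y * (y p.1 * y p.2) - if p.1 = p.2 then 1 else 0 := by
  simp [vecStat, vec, vecMulVec_apply, one_apply, eq_comm, mul_comm]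

lemma continuous_weighted (hν : 2 < ν) (i j : Fin d) :
    Continuous fun y : Fin d → ℝ => tWeight ν y * (y i * y j) :=
  (continuous_tWeight hν).mul ((continuous_apply i).mul (continuous_apply j))

lemma continuous_vecStat (hν : 2 < ν) (p : Fin d × Fin d) :
    Continuous fun y : Fin d → ℝ => vecStat ν y p := by
  simp only [vecStat_apply]
  exact (continuous_weighted hν _ _).sub continuous_const

lemma continuous_radialStat (hν : 2 < ν) : Continuous (radialStat ν : (Fin d → ℝ) → ℝ) :=
  continuous_const.sub (((continuous_tWeight hν).mul continuous_dotProduct_self).div_const _)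

lemma abs_vecStat_le (hν : 2 < ν) (y : Fin d → ℝ) (p : Fin d × Fin d) :
    |vecStat ν y p| ≤ ν + d + 1 := by
  rw [vecStat_apply]
  refine (abs_sub _ _).trans (add_le_add (tWeight_mul_abs_le hν y _ _) ?_)
  split_ifs <;> simp

lemma tWeight_mul_dotProduct (y : Fin d → ℝ) :
    tWeight ν y * (y ⬝ᵥ y) = ∑ i, tWeight ν y * (y i * y i) := by
  rw [dotProduct, Finset.mul_sum]

lemma abs_radialStat_le (hν : 2 < ν) (y : Fin d → ℝ) : |radialStat ν y| ≤ 1 + (ν + d) / d := by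
  refine (abs_sub _ _).trans (add_le_add (by simp) ?_)
  have h := tDenom_pos hν y
  have h0 := dotProduct_self_nonneg' y
  have hd : 0 < ν + d := by positivity
  rw [abs_div, Nat.abs_cast]
  gcongr
  rw [tWeight, div_mul_eq_mul_div, abs_of_nonneg (by positivity), div_le_iff₀ h]
  gcongr
  linarith

lemma integrable_weighted (hν : 2 < ν) (i j : Fin d) :
    Integrable (fun y => tWeight ν y * (y i * y j)) (tStd ν (1 : Matrix (Fin d) (Fin d) ℝ)) :=
  integrable_tStd_of_bound hν (continuous_weighted hν i j) (tWeight_mul_abs_le hν · i j)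

lemma integrable_weighted_mul (hν : 2 < ν) (i j k l : Fin d) :
    Integrable (fun y => tWeight ν y * (y i * y j) * (tWeight ν y * (y k * y l)))
      (tStd ν (1 : Matrix (Fin d) (Fin d) ℝ)) := by
  refine integrable_tStd_of_bound hν
    ((continuous_weighted hν i j).mul (continuous_weighted hν k l))
    (c := (ν + d) * (ν + d)) fun y => ?_
  rw [abs_mul]
  exact mul_le_mul (tWeight_mul_abs_le hν y i j) (tWeight_mul_abs_le hν y k l) (abs_nonneg _)
    (by positivity)

lemma integral_vecStat (hν : 2 < ν) (p : Fin d × Fin d) :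
    ∫ y, vecStat ν y p ∂tStd ν (1 : Matrix (Fin d) (Fin d) ℝ) = 0 := by
  have := isProbabilityMeasure_tStd_one (d := d) hν
  simp only [vecStat_apply]
  rw [integral_sub (integrable_weighted hν _ _) (integrable_const _),
    integral_tStd_weight_two hν]
  simp

/-- Of the three pairings in the fourth moment, the two crossed ones give `φ (I + K)`. The pairing
`δ_ab δ_ce` has coefficient `φ`, and centring subtracts 1. -/
lemma integral_vecStat_mul (hν : 2 < ν) (p q : Fin d × Fin d) :
    ∫ y, vecStat ν y p * vecStat ν y q ∂tStd ν (1 : Matrix (Fin d) (Fin d) ℝ) =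
      (((ν + d) / (ν + d + 2)) • (1 + commMat (Fin d) : Matrix _ _ ℝ) + ((ν + d) / (ν + d + 2) - 1) •
        vecMulVec (vec (1 : Matrix (Fin d) (Fin d) ℝ)) (vec 1) :
          Matrix (Fin d × Fin d) (Fin d × Fin d) ℝ) p q := by
  have := isProbabilityMeasure_tStd_one (d := d) hν
  obtain ⟨a, b⟩ := p
  obtain ⟨c, e⟩ := q
  have s : ∀ y : Fin d → ℝ, vecStat ν y (a, b) * vecStat ν y (c, e) =
      tWeight ν y * (y a * y b) * (tWeight ν y * (y c * y e))
      - (if c = e then 1 else 0) * (tWeight ν y * (y a * y b))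
      - (if a = b then 1 else 0) * (tWeight ν y * (y c * y e))
      + (if a = b then 1 else 0) * (if c = e then 1 else 0) := fun y => by
    simp only [vecStat_apply]; ring
  simp_rw [s]
  have i1 := integrable_weighted_mul hν a b c e
  have i2 := (integrable_weighted hν a b).const_mul (if c = e then 1 else 0)
  have i3 := (integrable_weighted hν c e).const_mul (if a = b then 1 else 0)
  have i4 : Integrable (fun y => tWeight ν y * (y a * y b) * (tWeight ν y * (y c * y e))
      - (if c = e then 1 else 0) * (tWeight ν y * (y a * y b))) (tStd ν 1) := i1.sub i2
  have i5 : Integrable (fun y => tWeight ν y * (y a * y b) * (tWeight ν y * (y c * y e))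
      - (if c = e then 1 else 0) * (tWeight ν y * (y a * y b))
      - (if a = b then 1 else 0) * (tWeight ν y * (y c * y e))) (tStd ν 1) := i4.sub i3
  rw [integral_add i5 (integrable_const _), integral_sub i4 i3, integral_sub i1 i2, integral_const_mul, integral_const_mul,
    integral_tStd_weight_four hν, integral_tStd_weight_two hν, integral_tStd_weight_two hν]
  have hδ : ∀ (P Q : Prop) [Decidable P] [Decidable Q],
      (if P ∧ Q then (1 : ℝ) else 0) = (if P then 1 else 0) * (if Q then 1 else 0) :=
    fun P Q _ _ => by split_ifs <;> simp_all
  simp only [integral_const, probReal_univ, Matrix.add_apply, Matrix.smul_apply,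
    one_apply, Prod.mk.injEq, commMat, of_apply, vecMulVec_apply, vec, smul_eq_mul,
    eq_comm (a := b) (b := a), eq_comm (a := e) (b := c), hδ]
  ring

lemma integral_radialStat (hν : 2 < ν) (hd : d ≠ 0) :
    ∫ y, radialStat ν y ∂tStd ν (1 : Matrix (Fin d) (Fin d) ℝ) = 0 := by
  have := isProbabilityMeasure_tStd_one (d := d) hν
  have hd' : (d : ℝ) ≠ 0 := Nat.cast_ne_zero.2 hd
  simp only [radialStat, tWeight_mul_dotProduct]
  rw [integral_sub (integrable_const _)
    ((integrable_finsetSum _ fun i _ => integrable_weighted hν i i).div_const _),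
    integral_div, integral_finsetSum _ fun i _ => integrable_weighted hν i i]
  simp [integral_tStd_weight_two hν, hd']

/-- Summing the fourth moments over `i, j` gives `E[(W y'y)²] = φ (d² + 2d)`, while `E[W y'y] = d`;
hence `1 - 2 + φ (1 + 2/d)`. -/
lemma integral_radialStat_sq (hν : 2 < ν) (hd : d ≠ 0) :
    ∫ y, radialStat ν y * radialStat ν y ∂tStd ν (1 : Matrix (Fin d) (Fin d) ℝ) =
      (ν + d) / (ν + d + 2) - 1 + 2 * ((ν + d) / (ν + d + 2)) / d := by
  have := isProbabilityMeasure_tStd_one (d := d) hν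
  have hd' : (d : ℝ) ≠ 0 := Nat.cast_ne_zero.2 hd
  have s : ∀ y : Fin d → ℝ, radialStat ν y * radialStat ν y =
      1 - 2 / d * (∑ i, tWeight ν y * (y i * y i)) + 1 / (d : ℝ) ^ 2 *
        ∑ i, ∑ j, tWeight ν y * (y i * y i) * (tWeight ν y * (y j * y j)) := fun y => by
    rw [← Finset.sum_mul_sum, radialStat, tWeight_mul_dotProduct]
    field_simp; ring
  simp_rw [s]
  have i1 := (integrable_finsetSum Finset.univ fun i _ =>
    integrable_weighted (d := d) hν i i).const_mul (2 / (d : ℝ))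
  have i2' : ∀ i ∈ Finset.univ, Integrable (fun y : Fin d → ℝ =>
      ∑ j, tWeight ν y * (y i * y i) * (tWeight ν y * (y j * y j))) (tStd ν 1) :=
    fun i _ => integrable_finsetSum Finset.univ fun j _ => integrable_weighted_mul hν i i j j
  have i2 := (integrable_finsetSum Finset.univ i2').const_mul (1 / (d : ℝ) ^ 2)
  have i3 : Integrable (fun y : Fin d → ℝ =>
      1 - 2 / d * (∑ i, tWeight ν y * (y i * y i))) (tStd ν 1) := (integrable_const _).sub i1
  rw [integral_add i3 i2, integral_sub (integrable_const _) i1,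
    integral_const_mul, integral_const_mul,
    integral_finsetSum _ fun i _ => integrable_weighted hν i i, integral_finsetSum _ i2']
  have e : ∀ i j : Fin d, ∫ y, tWeight ν y * (y i * y i) * (tWeight ν y * (y j * y j)) ∂tStd ν 1 =
      (ν + d) / (ν + d + 2) * (1 + 2 * if i = j then 1 else 0) := fun i j => by
    rw [integral_tStd_weight_four hν]
    by_cases h : i = j <;> simp [h]
    norm_num
  simp_rw [integral_finsetSum Finset.univ fun j _ => integrable_weighted_mul hν _ _ j j, e,
    integral_tStd_weight_two hν, ← Finset.mul_sum, Finset.sum_add_distrib, ← Finset.mul_sum]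
  simp
  field_simp
  ring

end ScoreStatistics

/-! ### Fisher information -/

lemma integral_mulVec_mul_mulVec {Ω p ι : Type*} [MeasurableSpace Ω] [Fintype ι]
    {μ : Measure Ω} (M : Matrix p ι ℝ) (w : Ω → ι → ℝ) {G : Matrix ι ι ℝ}
    (hi : ∀ i j, Integrable (fun x => w x i * w x j) μ)
    (hG : ∀ i j, ∫ x, w x i * w x j ∂μ = G i j) (a b : p) :
    Integrable (fun x => (M *ᵥ w x) a * (M *ᵥ w x) b) μ ∧
      ∫ x, (M *ᵥ w x) a * (M *ᵥ w x) b ∂μ = (M * G * Mᵀ) a b := by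
  have s : ∀ x, (M *ᵥ w x) a * (M *ᵥ w x) b =
      ∑ i, ∑ j, M a i * M b j * (w x i * w x j) := fun x => by
    simp only [mulVec, dotProduct, Finset.sum_mul_sum]
    exact Finset.sum_congr rfl fun i _ => Finset.sum_congr rfl fun j _ => by ring
  have hij := fun i j => (hi i j).const_mul (M a i * M b j)
  have hs := fun i => integrable_finsetSum Finset.univ fun j _ => hij i j
  simp_rw [s]
  refine ⟨integrable_finsetSum _ fun i _ => hs i, ?_⟩
  rw [integral_finsetSum _ fun i _ => hs i]
  simp_rw [integral_finsetSum Finset.univ fun j _ => hij _ j, integral_const_mul, hG, mul_apply,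
    transpose_apply, Finset.sum_mul]
  rw [Finset.sum_comm]
  exact Finset.sum_congr rfl fun i _ => Finset.sum_congr rfl fun j _ => by ring

lemma integral_pi_mul_of_ne {G : Type*} [Fintype G] {E : G → Type*}
    [∀ g, MeasurableSpace (E g)] (μ : ∀ g, Measure (E g)) [∀ g, IsProbabilityMeasure (μ g)]
    {g g' : G} (hg : g ≠ g') {f : E g → ℝ} {f' : E g' → ℝ} (hf : Measurable f)
    (hf' : Measurable f') :
    ∫ V, f (V g) * f' (V g') ∂Measure.pi μ = (∫ y, f y ∂μ g) * ∫ y, f' y ∂μ g' := by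
  have h := (ProbabilityTheory.iIndepFun_pi (μ := μ) (X := fun _ => id)
    fun _ => aemeasurable_id).indepFun hg
  have h2 := h.comp hf hf'
  have h3 := h2.integral_fun_mul_eq_mul_integral
    (hf.comp (measurable_pi_apply g)).aestronglyMeasurable
    (hf'.comp (measurable_pi_apply g')).aestronglyMeasurable
  rw [← integral_comp_eval (μ := μ) hf.aestronglyMeasurable,
    ← integral_comp_eval (μ := μ) hf'.aestronglyMeasurable]
  exact h3

section Fisher

variable {K : ℕ} {n : Fin K → ℕ} {F : ∀ k, Matrix (Fin (n k)) (Fin (n k - 1)) ℝ}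
  {ν : Option (Fin K) → ℝ} {ρ : Matrix (Fin K) (Fin K) ℝ}

lemma commMat_mul_kronecker {ι : Type*} [Fintype ι] [DecidableEq ι] (R : Matrix ι ι ℝ) :
    commMat ι * (R ⊗ₖ R) = (R ⊗ₖ R) * commMat ι := by
  ext ⟨a, b⟩ ⟨c, e⟩
  simp [Matrix.mul_apply, commMat, Fintype.sum_prod_type, kroneckerMap_apply, ite_and, mul_comm]

/-- The measurable equivalence `V ↦ C^{1/2} Q V` between the stacked vectors and the sample
space. -/
def sampleEquiv (hn : ∀ k, 2 ≤ n k) (hF : IsPerpBasis n F) (hpos : (blockCorr n ρ).PosDef) :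
    (∀ g, Fin (canonDims n g) → ℝ) ≃ᵐ ((Σ k, Fin (n k)) → ℝ) :=
  (MeasurableEquiv.piCurry fun g (_ : Fin (canonDims n g)) => ℝ).symm.trans
    (mulVecEquiv (msqrt (blockCorr n ρ) * canonQ n F)
      ((canonQ n F)ᵀ * (msqrt (blockCorr n ρ))⁻¹)
      (by
        have hu := (msqrt_det_pos hpos).ne'.isUnit
        rw [Matrix.mul_assoc, ← Matrix.mul_assoc (canonQ n F), canonQ_mul_transpose hn hF,
          Matrix.one_mul, mul_nonsing_inv _ hu])
      (by
        have hu := (msqrt_det_pos hpos).ne'.isUnit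
        rw [Matrix.mul_assoc, ← Matrix.mul_assoc (msqrt (blockCorr n ρ))⁻¹,
          nonsing_inv_mul _ hu, Matrix.one_mul, canonQ_transpose_mul_self hn hF]))

lemma ctStd_eq_map_sampleEquiv (hn : ∀ k, 2 ≤ n k) (hF : IsPerpBasis n F)
    (hpos : (blockCorr n ρ).PosDef) :
    ctStd (canonDims n) ν (msqrt (blockCorr n ρ) * canonQ n F) =
      (Measure.pi fun g => tStd (ν g)
        (1 : Matrix (Fin (canonDims n g)) (Fin (canonDims n g)) ℝ)).map
          (sampleEquiv hn hF hpos) := rfl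

/-- `Q' C^{-1/2}` inverts `C^{1/2} Q`, so the standardized canonical variables are the generating
vectors themselves. -/
lemma canonical_sampleEquiv (hn : ∀ k, 2 ≤ n k) (hF : IsPerpBasis n F)
    (hpos : (blockCorr n ρ).PosDef) (V : ∀ g, Fin (canonDims n g) → ℝ) (g : Option (Fin K))
    (j : Fin (canonDims n g)) :
    ((canonQ n F)ᵀ *ᵥ ((msqrt (blockCorr n ρ))⁻¹ *ᵥ sampleEquiv hn hF hpos V)) ⟨g, j⟩ = V g j := by
  have h := congrFun (congrFun ((sampleEquiv hn hF hpos).symm_apply_apply V) g) j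
  rw [mulVec_mulVec]
  exact h

lemma X0_sampleEquiv (hn : ∀ k, 2 ≤ n k) (hF : IsPerpBasis n F)
    (hpos : (blockCorr n ρ).PosDef) (V : ∀ g, Fin (canonDims n g) → ℝ) :
    X0 n F (blockCorr n ρ) (sampleEquiv hn hF hpos V) = V none :=
  funext fun j => canonical_sampleEquiv hn hF hpos V none j

lemma Xk_sampleEquiv (hn : ∀ k, 2 ≤ n k) (hF : IsPerpBasis n F)
    (hpos : (blockCorr n ρ).PosDef) (V : ∀ g, Fin (canonDims n g) → ℝ) (k : Fin K) :
    Xk n F (blockCorr n ρ) (sampleEquiv hn hF hpos V) k = V (some k) :=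
  funext fun j => canonical_sampleEquiv hn hF hpos V (some k) j

/-- The independent statistics of which the score is a linear function. -/
def scoreStat (n : Fin K → ℕ) (ν : Option (Fin K) → ℝ) (V : ∀ g, Fin (canonDims n g) → ℝ) :
    (Fin K × Fin K) ⊕ Fin K → ℝ :=
  Sum.elim (vecStat (d := K) (ν none) (V none))
    fun k => radialStat (d := n k - 1) (ν (some k)) (V (some k))

/-- The matrix of second moments of `scoreStat`. -/
def scoreStatCov (n : Fin K → ℕ) (ν : Option (Fin K) → ℝ) :
    Matrix ((Fin K × Fin K) ⊕ Fin K) ((Fin K × Fin K) ⊕ Fin K) ℝ :=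
  fromBlocks (phi0 ν • (1 + commMat (Fin K)) +
      (phi0 ν - 1) • vecMulVec (vec (1 : Matrix (Fin K) (Fin K) ℝ)) (vec 1)) 0 0
    (diagonal fun k => phik n ν k - 1 + 2 * phik n ν k / ((n k : ℝ) - 1))

/-- The matrix expressing the score through `scoreStat`. -/
def scoreLoading (n : Fin K → ℕ) (A : Matrix (Fin K) (Fin K) ℝ) :
    Matrix (Fin K × Fin K) ((Fin K × Fin K) ⊕ Fin K) ℝ :=
  fromCols ((msqrt A)⁻¹ ⊗ₖ (msqrt A)⁻¹)
    ((diagElim (Fin K))ᵀ * diagonal fun k => (lam n A k)⁻¹)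

/-- Since `ν_k + n_k - 1 = ν_k + d` for `d = n_k - 1`, the entry `S_k` is `radialStat` divided by
`λ_k`. -/
lemma score_sampleEquiv (hn : ∀ k, 2 ≤ n k) (hF : IsPerpBasis n F) (hν : ∀ g, 2 < ν g)
    (hpos : (blockCorr n ρ).PosDef) (V : ∀ g, Fin (canonDims n g) → ℝ) :
    score n F ν (canonA n ρ) (sampleEquiv hn hF hpos V) =
      (1 / 2 : ℝ) • (scoreLoading n (canonA n ρ) *ᵥ scoreStat n ν V) := by
  rw [score_eq hn hF hν hpos, scoreLoading, scoreStat, fromCols_mulVec_sumElim, smul_add]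
  congr 2
  · rw [W0, X0_sampleEquiv]
    rfl
  · rw [← mulVec_mulVec]
    congr 1
    ext k
    have hl := (lam_pos hn hF hpos k).ne'
    have hn2 : (2 : ℝ) ≤ n k := by exact_mod_cast hn k
    have hn1 : (n k : ℝ) - 1 ≠ 0 := by linarith
    have h : ∀ y : Fin (n k - 1) → ℝ, 1 / lam n (canonA n ρ) k -
        (ν (some k) + n k - 1) / (ν (some k) - 2 + y ⬝ᵥ y) * (y ⬝ᵥ y) /
          (lam n (canonA n ρ) k * ((n k : ℝ) - 1)) =
        (lam n (canonA n ρ) k)⁻¹ * radialStat (ν (some k)) y := fun y => by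
      have hy := (tDenom_pos (hν (some k)) y).ne'
      rw [radialStat, tWeight, natCast_sub_one hn, ← add_sub_assoc]
      field_simp
    rw [mulVec_diagonal, Svec, Wk, Xk_sampleEquiv]
    exact h _

lemma isProbabilityMeasure_tStd_canonDims (hν : ∀ g, 2 < ν g) (g : Option (Fin K)) :
    IsProbabilityMeasure
      (tStd (ν g) (1 : Matrix (Fin (canonDims n g)) (Fin (canonDims n g)) ℝ)) :=
  isProbabilityMeasure_tStd_one (hν g)

lemma integrable_scoreStat_mul (hν : ∀ g, 2 < ν g) (i j : (Fin K × Fin K) ⊕ Fin K) :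
    Integrable (fun V => scoreStat n ν V i * scoreStat n ν V j)
      (Measure.pi fun g => tStd (ν g)
        (1 : Matrix (Fin (canonDims n g)) (Fin (canonDims n g)) ℝ)) := by
  have hP := isProbabilityMeasure_tStd_canonDims (n := n) hν
  have hb : ∀ i, ∃ c, ∀ V, |scoreStat n ν V i| ≤ c := by
    rintro (p | k)
    · exact ⟨_, fun V => abs_vecStat_le (hν none) _ p⟩
    · exact ⟨_, fun V => abs_radialStat_le (hν (some k)) _⟩
  have hm : ∀ i, Measurable fun V => scoreStat n ν V i := by
    rintro (p | k)
    · exact (continuous_vecStat (d := K) (hν none) p).measurable.comp (measurable_pi_apply none)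
    · exact (continuous_radialStat (d := n k - 1) (hν (some k))).measurable.comp
        (measurable_pi_apply (some k))
  obtain ⟨c, hc⟩ := hb i
  obtain ⟨c', hc'⟩ := hb j
  refine Integrable.of_bound ((hm i).mul (hm j)).aestronglyMeasurable (c * c')
    (.of_forall fun V => ?_)
  rw [norm_mul]
  exact mul_le_mul (hc V) (hc' V) (abs_nonneg _) ((abs_nonneg _).trans (hc V))

/-- Statistics of different groups are independent and centred, so all cross moments between groups
vanish. -/
lemma integral_scoreStat_mul (hn : ∀ k, 2 ≤ n k) (hν : ∀ g, 2 < ν g)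
    (i j : (Fin K × Fin K) ⊕ Fin K) :
    ∫ V, scoreStat n ν V i * scoreStat n ν V j ∂(Measure.pi fun g => tStd (ν g)
        (1 : Matrix (Fin (canonDims n g)) (Fin (canonDims n g)) ℝ)) = scoreStatCov n ν i j := by
  have hP := isProbabilityMeasure_tStd_canonDims (n := n) hν
  have hv := fun p => continuous_vecStat (d := K) (hν none) p
  have hr := fun k => continuous_radialStat (d := n k - 1) (hν (some k))
  have hd : ∀ k, n k - 1 ≠ 0 := fun k => by have := hn k; omega
  rcases i with p | k <;> rcases j with q | l
  · refine (integral_comp_eval (μ := fun g => tStd (ν g)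
      (1 : Matrix (Fin (canonDims n g)) (Fin (canonDims n g)) ℝ)) (i := none)
      ((hv p).mul (hv q)).aestronglyMeasurable).trans ?_
    exact integral_vecStat_mul (hν none) p q
  · refine (integral_pi_mul_of_ne (fun g => tStd (ν g)
      (1 : Matrix (Fin (canonDims n g)) (Fin (canonDims n g)) ℝ)) (g := none) (g' := some l)
      (Option.some_ne_none l).symm (hv p).measurable (hr l).measurable).trans ?_
    exact (congrArg (· * _) (integral_vecStat (hν none) p)).trans (zero_mul _)
  · refine (integral_pi_mul_of_ne (fun g => tStd (ν g)
      (1 : Matrix (Fin (canonDims n g)) (Fin (canonDims n g)) ℝ)) (g := some k) (g' := none)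
      (Option.some_ne_none k) (hr k).measurable (hv q).measurable).trans ?_
    exact (congrArg (_ * ·) (integral_vecStat (hν none) q)).trans (mul_zero _)
  · rw [scoreStatCov, fromBlocks_apply₂₂]
    by_cases hkl : k = l
    · subst hkl
      refine (integral_comp_eval (μ := fun g => tStd (ν g)
        (1 : Matrix (Fin (canonDims n g)) (Fin (canonDims n g)) ℝ)) (i := some k)
        ((hr k).mul (hr k)).aestronglyMeasurable).trans ?_
      refine (integral_radialStat_sq (hν (some k)) (hd k)).trans ?_
      rw [diagonal_apply_eq, natCast_sub_one hn, phik]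
      rw [show ν (some k) + ((n k : ℝ) - 1) = ν (some k) + n k - 1 by ring,
        show ν (some k) + (n k : ℝ) - 1 + 2 = ν (some k) + n k + 1 by ring]
    · rw [diagonal_apply_ne _ hkl]
      refine (integral_pi_mul_of_ne (fun g => tStd (ν g)
        (1 : Matrix (Fin (canonDims n g)) (Fin (canonDims n g)) ℝ)) (g := some k) (g' := some l)
        (fun h => hkl (Option.some_injective _ h)) (hr k).measurable (hr l).measurable).trans ?_
      exact (congrArg (· * _) (integral_radialStat (hν (some k)) (hd k))).trans (zero_mul _)

/-- `R ⊗ R` commutes with the commutation matrix and sends `vec I` to `vec A⁻¹`; the two factors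
`1/λ_k` account for `λ_k²` in `Ξ`. -/
lemma scoreLoading_mul_cov {A : Matrix (Fin K) (Fin K) ℝ} (hA : A.PosDef)
    (hl : ∀ k, 0 < lam n A k) :
    scoreLoading n A * scoreStatCov n ν * (scoreLoading n A)ᵀ =
      phi0 ν • ((A⁻¹ ⊗ₖ A⁻¹) * (1 + commMat (Fin K)))
        + (phi0 ν - 1) • vecMulVec (vec A⁻¹) (vec A⁻¹)
        + (diagElim (Fin K))ᵀ * Xi n ν A * diagElim (Fin K) := by
  have hR := inv_msqrt_transpose A
  have hLt : ((msqrt A)⁻¹ ⊗ₖ (msqrt A)⁻¹)ᵀ = (msqrt A)⁻¹ ⊗ₖ (msqrt A)⁻¹ := by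
    rw [← kroneckerMap_transpose, hR]
  have hLL : ((msqrt A)⁻¹ ⊗ₖ (msqrt A)⁻¹) * ((msqrt A)⁻¹ ⊗ₖ (msqrt A)⁻¹) = A⁻¹ ⊗ₖ A⁻¹ := by
    rw [← mul_kronecker_mul, inv_msqrt_mul_self hA]
  have hLv : ((msqrt A)⁻¹ ⊗ₖ (msqrt A)⁻¹) *ᵥ vec (1 : Matrix (Fin K) (Fin K) ℝ) = vec A⁻¹ := by
    rw [kronecker_mulVec_vec, Matrix.mul_one, hR, inv_msqrt_mul_self hA]
  rw [scoreLoading, scoreStatCov, transpose_fromCols, fromCols_mul_fromBlocks,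
    fromCols_mul_fromRows, Matrix.mul_zero, Matrix.mul_zero, zero_add, add_zero, hLt]
  congr 1
  · rw [Matrix.mul_add, Matrix.add_mul, Matrix.mul_smul, Matrix.mul_smul, Matrix.smul_mul,
      Matrix.smul_mul, mul_vecMulVec, vecMulVec_mul, ← mulVec_transpose, hLt, hLv,
      Matrix.mul_assoc, Matrix.add_mul, Matrix.one_mul, commMat_mul_kronecker, Matrix.mul_add,
      ← Matrix.mul_assoc, hLL, Matrix.mul_add, Matrix.mul_one]
  · rw [transpose_mul, transpose_transpose, diagonal_transpose]
    have hX : Xi n ν A = (diagonal fun k => (lam n A k)⁻¹) *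
        (diagonal fun k => phik n ν k - 1 + 2 * phik n ν k / ((n k : ℝ) - 1)) *
        diagonal fun k => (lam n A k)⁻¹ := by
      rw [diagonal_mul_diagonal, diagonal_mul_diagonal, Xi]
      congr 1
      ext k
      have := (hl k).ne'
      rw [← div_div]
      field_simp
    rw [hX]
    simp only [Matrix.mul_assoc]

/-- The Fisher information in the sample space. -/
lemma integral_score_mul_ctStd (hn : ∀ k, 2 ≤ n k) (hF : IsPerpBasis n F) (hν : ∀ g, 2 < ν g)
    (hpos : (blockCorr n ρ).PosDef) (p q : Fin K × Fin K) :
    Integrable (fun z => score n F ν (canonA n ρ) z p * score n F ν (canonA n ρ) z q)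
        (ctStd (canonDims n) ν (msqrt (blockCorr n ρ) * canonQ n F)) ∧
      ∫ z, score n F ν (canonA n ρ) z p * score n F ν (canonA n ρ) z q
        ∂ctStd (canonDims n) ν (msqrt (blockCorr n ρ) * canonQ n F) =
      ((1 / 4 : ℝ) • (phi0 ν • (((canonA n ρ)⁻¹ ⊗ₖ (canonA n ρ)⁻¹) * (1 + commMat (Fin K)))
        + (phi0 ν - 1) • vecMulVec (vec (canonA n ρ)⁻¹) (vec (canonA n ρ)⁻¹)
        + (diagElim (Fin K))ᵀ * Xi n ν (canonA n ρ) * diagElim (Fin K)) :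
          Matrix (Fin K × Fin K) (Fin K × Fin K) ℝ) p q := by
  obtain ⟨h1, h2⟩ := integral_mulVec_mul_mulVec (scoreLoading n (canonA n ρ)) (scoreStat n ν)
    (integrable_scoreStat_mul hν) (integral_scoreStat_mul hn hν) p q
  have hs : ∀ V, score n F ν (canonA n ρ) (sampleEquiv hn hF hpos V) p *
      score n F ν (canonA n ρ) (sampleEquiv hn hF hpos V) q =
      1 / 4 * ((scoreLoading n (canonA n ρ) *ᵥ scoreStat n ν V) p *
        (scoreLoading n (canonA n ρ) *ᵥ scoreStat n ν V) q) := fun V => by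
    rw [score_sampleEquiv hn hF hν hpos, Pi.smul_apply, Pi.smul_apply, smul_eq_mul, smul_eq_mul]
    ring
  rw [ctStd_eq_map_sampleEquiv hn hF hpos, integrable_map_equiv, integral_map_equiv]
  simp only [Function.comp_def, hs]
  refine ⟨h1.const_mul _, ?_⟩
  rw [integral_const_mul, h2, scoreLoading_mul_cov (canonA_posDef hn hF hpos)
    (lam_pos hn hF hpos), Matrix.smul_apply, smul_eq_mul]

end Fisher

end BlockCT

end

open BlockCT
theorem theorem6 {K : ℕ} (n : Fin K → ℕ) (hn : ∀ k, 2 ≤ n k)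
    (F : ∀ k, Matrix (Fin (n k)) (Fin (n k - 1)) ℝ) (hF : IsPerpBasis n F)
    (ν : Option (Fin K) → ℝ) (hν : ∀ g, 2 < ν g)
    (ρ : Matrix (Fin K) (Fin K) ℝ) (C : Matrix (Σ k, Fin (n k)) (Σ k, Fin (n k)) ℝ)
    (hC : C = blockCorr n ρ) (hpos : C.PosDef)
    (A : Matrix (Fin K) (Fin K) ℝ) (hA : A = canonA n ρ)
    {Ω : Type*} [MeasurableSpace Ω] (P : Measure Ω) [IsProbabilityMeasure P]
    (Z : Ω → (Σ k, Fin (n k)) → ℝ)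
    (hZ : ProbabilityTheory.HasLaw Z (ctStd (canonDims n) ν (msqrt C * canonQ n F)) P) :
    -- `logLik` is the log-density of the model at every admissible parameter value
    (∀ ρ' : Matrix (Fin K) (Fin K) ℝ, (blockCorr n ρ').PosDef →
      ctStd (canonDims n) ν (msqrt (blockCorr n ρ') * canonQ n F)
        = volume.withDensity fun z => ENNReal.ofReal (Real.exp (logLik n F ν (canonA n ρ') z))) ∧
    -- the score with respect to `vec A`
    (∀ z : (Σ k, Fin (n k)) → ℝ,
      DifferentiableAt ℝ (logLikVec n F ν z) (vec A) ∧
      score n F ν A z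
        = (1 / 2 : ℝ) • (((msqrt A)⁻¹ ⊗ₖ (msqrt A)⁻¹) *ᵥ
            (W0 n F ν C z •
                vec (vecMulVec (X0 n F C z) (X0 n F C z))
              - vec (1 : Matrix (Fin K) (Fin K) ℝ)))
          + (1 / 2 : ℝ) • ((diagElim (Fin K))ᵀ *ᵥ Svec n F ν A C z)) ∧
    -- the Fisher information matrix
    (∀ p q, Integrable (fun ω => score n F ν A (Z ω) p * score n F ν A (Z ω) q) P) ∧
    (Matrix.of fun p q => ∫ ω, score n F ν A (Z ω) p * score n F ν A (Z ω) q ∂P)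
      = (1 / 4 : ℝ) • (phi0 ν • ((A⁻¹ ⊗ₖ A⁻¹) * (1 + commMat (Fin K)))
          + (phi0 ν - 1) • vecMulVec (vec A⁻¹) (vec A⁻¹)
          + (diagElim (Fin K))ᵀ * Xi n ν A * diagElim (Fin K)) := by
  subst hC hA
  have hF' := integral_score_mul_ctStd (F := F) hn hF hν hpos
  refine ⟨fun ρ' hρ' => ctStd_eq_withDensity_logLik hn hF hν hρ',
    fun z => ⟨differentiableAt_logLikVec hν (canonA_posDef hn hF hpos) (lam_pos hn hF hpos) z,
      score_eq hn hF hν hpos z⟩, fun p q => ?_, ?_⟩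
  · have h := (hF' p q).1
    -- Only the law of `Z` enters, so integrability and expectation transfer from the sample space
    -- to `Ω`.
    rw [← hZ.map_eq] at h
    exact (integrable_map_measure h.aestronglyMeasurable hZ.aemeasurable).1 h
  · ext p q
    rw [of_apply, ← (hF' p q).2]
    exact hZ.integral_comp (hF' p q).1.aestronglyMeasurable
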